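/- Let $d\ge 1$ and $k\ge 0$ be integers, let $1\le p<\infty$, let $\Omega\subset\mathbb{R}^d$ be a bounded open set, and let $\mathcal F\subset W_0^{k,p}(\Omega)$, where $W^{k,p}(\Omega)$ is the real Sobolev space with norm $\|f\|_{W^{k,p}(\Omega)}=\sum_{|\alpha|\le k}\|D^\alpha f\|_{L^p(\Omega)}$ (with $W^{0,p}=L^p$) and $W_0^{k,p}(\Omega)$ is the closure of $C_c^\infty(\Omega)$ in it. For $f\in\mathcal F$, let $\tilde f$ and $\widetilde{D^\alpha f}$ denote the extensions by $0$ outside $\Omega$ of $f$ and $D^\alpha f$. Then $\tilde f\in W^{k,p}(\mathbb{R}^d)$ and $D^\alpha\tilde f=\widetilde{D^\alpha f}$ for $|\alpha|\le k$; put $\tilde{\mathcal F}=\{\tilde f: f\in\mathcal F\}$, and write $\tau_h g(x)=g(x+h)$. Consider the following conditions. - $\mathbf{B^{k,p}}$: there is $M>0$ with $\|f\|_{W^{k,p}(\Omega)}\le M$ (equivalently $\|\tilde f\|_{W^{k,p}(\mathbb{R}^d)}\le M$) for all $f\in\mathcal F$. - $\mathbf{B^{|\alpha|\in\{0,k\},p}}$: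 there is $M>0$ with $\|f\|_{L^p(\Omega)}+\sum_{|\alpha|=k}\|D^\alpha f\|_{L^p(\Omega)}\le M$ for all $f\in\mathcal F$. - $\mathbf{EI_\tau^{k,p}}$: there is $\delta:\mathbb{R}_{>0}\to\mathbb{R}_{>0}$ such that $\|\tau_h\tilde f-\tilde f\|_{W^{k,p}(\mathbb{R}^d)}<\varepsilon$ for all $f\in\mathcal F$, $\varepsilon>0$ and $h\in\mathbb{R}^d$ with $\|h\|<\delta(\varepsilon)$. - $\mathbf{EI_\tau^{|\alpha|=k,p}}$: there is $\delta:\mathbb{R}_{>0}\to\mathbb{R}_{>0}$ such that $\sum_{|\alpha|=k}\|\tau_h\widetilde{D^\alpha f}-\widetilde{D^\alpha f}\|_{L^p(\mathbb{R}^d)}<\varepsilon$ for all $f\in\mathcal F$, $\varepsilon>0$ and $h\in\mathbb{R}^d$ with $\|h\|<\delta(\varepsilon)$. - $\mathbf{E_\infty^{k,p}}$: for every $\varepsilon>0$ there is a measurable set $\omega(\varepsilon)\subset\mathbb{R}^d$ of finite Lebesgue measure such that $\bigl(\sum_{|\alpha|\le k}\int_{\mathbb{R}^d\setminus\omega(\varepsilon)}|D^\alpha\tilde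 f|^p\,d\lambda\bigr)^{1/p}<\varepsilon$ for all $f\in\mathcal F$. - $\mathbf{C^{k,p}}$: $\tilde{\mathcal F}$ is precompact in $W^{k,p}(\mathbb{R}^d)$, that is, its closure is compact. Then: 1. $\mathbf{B^{k,p}}$ and $\mathbf{B^{|\alpha|\in\{0,k\},p}}$ are equivalent. 2. If these hold, then $\mathbf{EI_\tau^{k,p}}$ and $\mathbf{EI_\tau^{|\alpha|=k,p}}$ are equivalent. 3. The following are equivalent: $\mathbf{C^{k,p}}$; $\mathbf{B^{k,p}}\wedge\mathbf{EI_\tau^{k,p}}\wedge\mathbf{E_\infty^{k,p}}$; $\mathbf{B^{k,p}}\wedge\mathbf{EI_\tau^{|\alpha|=k,p}}\wedge\mathbf{E_\infty^{k,p}}$; $\mathbf{B^{|\alpha|\in\{0,k\},p}}\wedge\mathbf{EI_\tau^{|\alpha|=k,p}}\wedge\mathbf{E_\infty^{k,p}}$. -/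

import Mathlib

open MeasureTheory TopologicalSpace
open scoped ENNReal ContDiff

noncomputable section

namespace SobolevCompactness

/-- Euclidean space `ℝ^d`. -/
abbrev E (d : ℕ) : Type := EuclideanSpace ℝ (Fin d)

/-- The multi-indices `α ∈ ℕ^d` of length `|α| = ∑ i, α i` at most `k`. -/
def multiIndicesLE (d k : ℕ) : Finset (Fin d → ℕ) :=
  (Fintype.piFinset fun _ => Finset.range (k + 1)).filter fun α => ∑ i, α i ≤ k

/-- The multi-indices `α ∈ ℕ^d` of length exactly `k`. -/
def multiIndicesEq (d k : ℕ) : Finset (Fin d → ℕ) :=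
  (multiIndicesLE d k).filter fun α => ∑ i, α i = k

theorem mem_multiIndicesLE {d k : ℕ} {α : Fin d → ℕ} :
    α ∈ multiIndicesLE d k ↔ ∑ i, α i ≤ k := by
  simp only [multiIndicesLE, Finset.mem_filter, Fintype.mem_piFinset, Finset.mem_range,
    and_iff_right_iff_imp]
  intro h i
  have := Finset.single_le_sum (f := α) (fun j _ => Nat.zero_le _) (Finset.mem_univ i)
  omega

theorem mem_multiIndicesEq {d k : ℕ} {α : Fin d → ℕ} :
    α ∈ multiIndicesEq d k ↔ ∑ i, α i = k := by
  simp only [multiIndicesEq, Finset.mem_filter, mem_multiIndicesLE]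
  omega

/-- The classical partial derivative `∂φ/∂x_i`. -/
def partialDeriv {d : ℕ} (i : Fin d) (φ : E d → ℝ) : E d → ℝ :=
  fun x => fderiv ℝ φ x (EuclideanSpace.single i 1)

/-- The classical derivative `∂_1^{α_1} ∂_2^{α_2} ⋯ ∂_d^{α_d} φ`. -/
def multiDeriv {d : ℕ} (α : Fin d → ℕ) (φ : E d → ℝ) : E d → ℝ :=
  (List.finRange d).foldr (fun i g => (partialDeriv i)^[α i] g) φ

/-- `φ ∈ C_c^∞(Ω)`. -/
structure IsTestFunction {d : ℕ} (Ω : Opens (E d)) (φ : E d → ℝ) : Prop where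
  smooth : ContDiff ℝ ∞ φ
  compact : HasCompactSupport φ
  subset : tsupport φ ⊆ (Ω : Set (E d))

/-- `v` is the weak derivative `D^α u` of `u` on `Ω`. -/
def HasWeakDeriv {d : ℕ} (Ω : Opens (E d)) (α : Fin d → ℕ) (u v : E d → ℝ) : Prop :=
  ∀ φ : E d → ℝ, IsTestFunction Ω φ →
    ∫ x in (Ω : Set (E d)), u x * multiDeriv α φ x =
      (-1) ^ (∑ i, α i) * ∫ x in (Ω : Set (E d)), v x * φ x

/-- `L^p(Ω)` with respect to Lebesgue measure. -/
abbrev LpOn {d : ℕ} (Ω : Opens (E d)) (p : ℝ≥0∞) : Type :=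
  Lp ℝ p ((volume : Measure (E d)).restrict (Ω : Set (E d)))

section Basic

variable {d : ℕ} {Ω : Opens (E d)} {p : ℝ≥0∞}

theorem IsTestFunction.partialDeriv {φ : E d → ℝ} (h : IsTestFunction Ω φ) (i : Fin d) :
    IsTestFunction Ω (partialDeriv i φ) where
  smooth := (h.smooth.fderiv_right (m := ∞) (by simp)).clm_apply contDiff_const
  compact := h.compact.fderiv_apply ℝ _
  subset := (tsupport_fderiv_apply_subset ℝ _).trans h.subset

theorem IsTestFunction.multiDeriv {φ : E d → ℝ} (h : IsTestFunction Ω φ) (α : Fin d → ℕ) :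
    IsTestFunction Ω (multiDeriv α φ) := by
  unfold SobolevCompactness.multiDeriv
  induction List.finRange d with
  | nil => exact h
  | cons i l ih =>
    simp only [List.foldr_cons]
    generalize List.foldr _ φ l = g at ih
    induction α i with
    | zero => exact ih
    | succ n ihn => rw [Function.iterate_succ_apply']; exact ihn.partialDeriv i

theorem integrable_mul_test [Fact (1 ≤ p)] (u : LpOn Ω p) {φ : E d → ℝ}
    (h : IsTestFunction Ω φ) :
    Integrable (fun x => u x * φ x) (volume.restrict (Ω : Set (E d))) := by
  have hl := (Lp.memLp u).locallyIntegrable (Fact.out : 1 ≤ p)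
  simpa only [smul_eq_mul, mul_comm] using
    hl.integrable_smul_left_of_hasCompactSupport h.smooth.continuous h.compact

theorem multiDeriv_zero (φ : E d → ℝ) : multiDeriv 0 φ = φ := by
  unfold multiDeriv
  induction List.finRange d with
  | nil => rfl
  | cons i l ih => simp

theorem hasWeakDeriv_zero (u : E d → ℝ) : HasWeakDeriv Ω 0 u u := by
  intro φ _
  simp [multiDeriv_zero]

theorem HasWeakDeriv.add [Fact (1 ≤ p)] {α : Fin d → ℕ} {u u' v v' : LpOn Ω p}
    (h : HasWeakDeriv Ω α u v) (h' : HasWeakDeriv Ω α u' v') :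
    HasWeakDeriv Ω α (u + u' : LpOn Ω p) (v + v' : LpOn Ω p) := by
  intro φ hφ
  have e1 : ∫ x in (Ω : Set (E d)), (u + u' : LpOn Ω p) x * multiDeriv α φ x =
      ∫ x in (Ω : Set (E d)), (u x * multiDeriv α φ x + u' x * multiDeriv α φ x) := by
    refine integral_congr_ae ?_
    filter_upwards [Lp.coeFn_add u u'] with x hx
    rw [hx, Pi.add_apply, add_mul]
  have e2 : ∫ x in (Ω : Set (E d)), (v + v' : LpOn Ω p) x * φ x =
      ∫ x in (Ω : Set (E d)), (v x * φ x + v' x * φ x) := by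
    refine integral_congr_ae ?_
    filter_upwards [Lp.coeFn_add v v'] with x hx
    rw [hx, Pi.add_apply, add_mul]
  rw [e1, e2, integral_add (integrable_mul_test u (hφ.multiDeriv α))
    (integrable_mul_test u' (hφ.multiDeriv α)), integral_add (integrable_mul_test v hφ)
    (integrable_mul_test v' hφ), h φ hφ, h' φ hφ, mul_add]

theorem HasWeakDeriv.smul {α : Fin d → ℕ} {u v : LpOn Ω p} (c : ℝ)
    (h : HasWeakDeriv Ω α u v) :
    HasWeakDeriv Ω α (c • u : LpOn Ω p) (c • v : LpOn Ω p) := by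
  intro φ hφ
  have e1 : ∫ x in (Ω : Set (E d)), (c • u : LpOn Ω p) x * multiDeriv α φ x =
      ∫ x in (Ω : Set (E d)), c * (u x * multiDeriv α φ x) := by
    refine integral_congr_ae ?_
    filter_upwards [Lp.coeFn_smul c u] with x hx
    rw [hx, Pi.smul_apply, smul_eq_mul, mul_assoc]
  have e2 : ∫ x in (Ω : Set (E d)), (c • v : LpOn Ω p) x * φ x =
      ∫ x in (Ω : Set (E d)), c * (v x * φ x) := by
    refine integral_congr_ae ?_
    filter_upwards [Lp.coeFn_smul c v] with x hx
    rw [hx, Pi.smul_apply, smul_eq_mul, mul_assoc]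
  rw [e1, e2, integral_const_mul, integral_const_mul, h φ hφ]
  ring

theorem HasWeakDeriv.unique [Fact (1 ≤ p)] {α : Fin d → ℕ} {u : E d → ℝ} {v w : LpOn Ω p}
    (hv : HasWeakDeriv Ω α u v) (hw : HasWeakDeriv Ω α u w) : v = w := by
  have hl : LocallyIntegrable (fun x => v x - w x) (volume.restrict (Ω : Set (E d))) :=
    ((Lp.memLp v).locallyIntegrable (Fact.out : 1 ≤ p)).sub
      ((Lp.memLp w).locallyIntegrable (Fact.out : 1 ≤ p))
  have key := Ω.isOpen.ae_eq_zero_of_integral_contDiff_smul_eq_zero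
    (hl.locallyIntegrableOn (Ω : Set (E d))) (fun φ h1 h2 h3 => by
      have hφ : IsTestFunction Ω φ := ⟨h1, h2, h3⟩
      have h := (hv φ hφ).symm.trans (hw φ hφ)
      have h' := mul_left_cancel₀ (pow_ne_zero _ (by norm_num)) h
      calc ∫ x in (Ω : Set (E d)), φ x • (v x - w x)
          = ∫ x in (Ω : Set (E d)), (v x * φ x - w x * φ x) := by
            congr 1; ext x; simp only [smul_eq_mul]; ring
        _ = 0 := by
            rw [integral_sub (integrable_mul_test v hφ) (integrable_mul_test w hφ), h', sub_self])
  refine Lp.ext ?_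
  filter_upwards [key, ae_restrict_mem Ω.isOpen.measurableSet] with x hx hxΩ
  exact sub_eq_zero.1 (hx hxΩ)

end Basic

/-- The functions in `L^p(Ω)` whose weak derivatives of all orders `|α| ≤ k` exist in `L^p(Ω)`. -/
def sobolevSubmodule {d : ℕ} (Ω : Opens (E d)) (k : ℕ) (p : ℝ≥0∞) [Fact (1 ≤ p)] :
    Submodule ℝ (LpOn Ω p) where
  carrier := {f | ∀ α ∈ multiIndicesLE d k, ∃ g : LpOn Ω p, HasWeakDeriv Ω α f g}
  add_mem' := by
    intro f f' hf hf' α hα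
    obtain ⟨g, hg⟩ := hf α hα
    obtain ⟨g', hg'⟩ := hf' α hα
    exact ⟨g + g', hg.add hg'⟩
  zero_mem' := by
    intro α _
    have e : ∀ ψ : E d → ℝ, ∫ x in (Ω : Set (E d)), (0 : LpOn Ω p) x * ψ x = 0 := by
      intro ψ
      refine integral_eq_zero_of_ae ?_
      filter_upwards [Lp.coeFn_zero ℝ p (volume.restrict (Ω : Set (E d)))] with x hx
      rw [hx, Pi.zero_apply, zero_mul]
    exact ⟨0, fun φ _ => by rw [e, e, mul_zero]⟩
  smul_mem' := by
    intro c f hf α hα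
    obtain ⟨g, hg⟩ := hf α hα
    exact ⟨c • g, hg.smul c⟩

/-- The Sobolev space `W^{k,p}(Ω)`; a type of its own, since it carries the Sobolev norm and not
the `L^p` norm. -/
def Sobolev {d : ℕ} (Ω : Opens (E d)) (k : ℕ) (p : ℝ≥0∞) [Fact (1 ≤ p)] : Type :=
  ↥(sobolevSubmodule Ω k p)

section Sobolev

variable {d : ℕ} {Ω : Opens (E d)} {k : ℕ} {p : ℝ≥0∞} [Fact (1 ≤ p)]

instance : AddCommGroup (Sobolev Ω k p) := inferInstanceAs (AddCommGroup ↥(sobolevSubmodule Ω k p))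

instance : Module ℝ (Sobolev Ω k p) := inferInstanceAs (Module ℝ ↥(sobolevSubmodule Ω k p))

/-- The underlying element of `L^p(Ω)`. -/
def Sobolev.toLp (f : Sobolev Ω k p) : LpOn Ω p := f.1

open Classical in
/-- The weak derivative `D^α f ∈ L^p(Ω)`; it exists and is unique for `|α| ≤ k` (for other `α` the
value is `0` if there is no weak derivative in `L^p(Ω)`). -/
def Sobolev.weakDeriv (α : Fin d → ℕ) (f : Sobolev Ω k p) : LpOn Ω p :=
  if h : ∃ g : LpOn Ω p, HasWeakDeriv Ω α f.toLp g then h.choose else 0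

theorem Sobolev.hasWeakDeriv {α : Fin d → ℕ} (hα : α ∈ multiIndicesLE d k) (f : Sobolev Ω k p) :
    HasWeakDeriv Ω α f.toLp (f.weakDeriv α) := by
  have h : ∃ g : LpOn Ω p, HasWeakDeriv Ω α f.toLp g := f.2 α hα
  rw [Sobolev.weakDeriv, dif_pos h]
  exact h.choose_spec

theorem Sobolev.weakDeriv_add {α : Fin d → ℕ} (hα : α ∈ multiIndicesLE d k)
    (f g : Sobolev Ω k p) : (f + g).weakDeriv α = f.weakDeriv α + g.weakDeriv α :=
  (Sobolev.hasWeakDeriv hα (f + g)).unique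
    ((Sobolev.hasWeakDeriv hα f).add (Sobolev.hasWeakDeriv hα g))

theorem Sobolev.weakDeriv_smul {α : Fin d → ℕ} (hα : α ∈ multiIndicesLE d k)
    (c : ℝ) (f : Sobolev Ω k p) : (c • f).weakDeriv α = c • f.weakDeriv α :=
  (Sobolev.hasWeakDeriv hα (c • f)).unique ((Sobolev.hasWeakDeriv hα f).smul c)

theorem Sobolev.weakDeriv_zero_index (f : Sobolev Ω k p) : f.weakDeriv 0 = f.toLp :=
  (Sobolev.hasWeakDeriv (mem_multiIndicesLE.2 (by simp)) f).unique (hasWeakDeriv_zero _)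

/-- The norm `‖f‖_{W^{k,p}(Ω)} = ∑_{|α| ≤ k} ‖D^α f‖_{L^p(Ω)}`. -/
def sobolevNorm (Ω : Opens (E d)) (k : ℕ) (p : ℝ≥0∞) [Fact (1 ≤ p)] :
    AddGroupNorm (Sobolev Ω k p) where
  toFun f := ∑ α ∈ multiIndicesLE d k, ‖f.weakDeriv α‖
  map_zero' := by
    refine Finset.sum_eq_zero fun α hα => ?_
    have := Sobolev.weakDeriv_smul hα 0 (0 : Sobolev Ω k p)
    rw [zero_smul, zero_smul] at this
    rw [this, norm_zero]
  add_le' f g := by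
    rw [← Finset.sum_add_distrib]
    refine Finset.sum_le_sum fun α hα => ?_
    rw [Sobolev.weakDeriv_add hα]
    exact norm_add_le _ _
  neg' f := by
    refine Finset.sum_congr rfl fun α hα => ?_
    have := Sobolev.weakDeriv_smul hα (-1) f
    rw [neg_one_smul, neg_one_smul] at this
    rw [this, norm_neg]
  eq_zero_of_map_eq_zero' f hf := by
    have h0 := (Finset.sum_eq_zero_iff_of_nonneg (fun α _ => norm_nonneg _)).1 hf 0
      (mem_multiIndicesLE.2 (by simp))
    rw [Sobolev.weakDeriv_zero_index, norm_eq_zero] at h0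
    exact Subtype.ext h0

instance : NormedAddCommGroup (Sobolev Ω k p) := (sobolevNorm Ω k p).toNormedAddCommGroup

theorem Sobolev.norm_def (f : Sobolev Ω k p) :
    ‖f‖ = ∑ α ∈ multiIndicesLE d k, ‖f.weakDeriv α‖ := rfl

/-- `W_0^{k,p}(Ω)`: the closure of `C_c^∞(Ω)` in `W^{k,p}(Ω)`. -/
def sobolevZero (Ω : Opens (E d)) (k : ℕ) (p : ℝ≥0∞) [Fact (1 ≤ p)] : Set (Sobolev Ω k p) :=
  closure {f | ∃ φ : E d → ℝ, IsTestFunction Ω φ ∧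
    f.toLp =ᵐ[volume.restrict (Ω : Set (E d))] φ}

end Sobolev

section Translation

variable {d k : ℕ} {p : ℝ≥0∞}

theorem measurePreserving_shift (h : E d) :
    MeasurePreserving (fun x : E d => x + h)
      (volume.restrict ((⊤ : Opens (E d)) : Set (E d)))
      (volume.restrict ((⊤ : Opens (E d)) : Set (E d))) := by
  simpa using measurePreserving_add_right (volume : Measure (E d)) h

theorem multiDeriv_shift (α : Fin d → ℕ) (φ : E d → ℝ) (h : E d) :
    multiDeriv α (fun x => φ (x + h)) = fun x => multiDeriv α φ (x + h) := by
  unfold multiDeriv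
  induction List.finRange d with
  | nil => rfl
  | cons i l ih =>
    simp only [List.foldr_cons]
    rw [ih]
    generalize List.foldr _ φ l = g
    induction α i with
    | zero => rfl
    | succ n ihn =>
      rw [Function.iterate_succ_apply', Function.iterate_succ_apply', ihn]
      funext x
      simp only [partialDeriv]
      rw [fderiv_comp_add_right]

theorem HasWeakDeriv.shift {α : Fin d → ℕ} {u v : LpOn (⊤ : Opens (E d)) p} (h : E d)
    (huv : HasWeakDeriv ⊤ α u v) :
    HasWeakDeriv ⊤ α (Lp.compMeasurePreserving _ (measurePreserving_shift h) u)
      (Lp.compMeasurePreserving _ (measurePreserving_shift h) v) := by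
  intro φ hφ
  have hψ : IsTestFunction (⊤ : Opens (E d)) (fun x => φ (x + -h)) :=
    ⟨hφ.smooth.comp (contDiff_id.add contDiff_const),
      hφ.compact.comp_homeomorph (Homeomorph.addRight (-h)), fun _ _ => trivial⟩
  have e : ∀ (w : LpOn (⊤ : Opens (E d)) p) (θ : E d → ℝ),
      ∫ x in ((⊤ : Opens (E d)) : Set (E d)),
        (Lp.compMeasurePreserving _ (measurePreserving_shift h) w : LpOn ⊤ p) x * θ x =
      ∫ x in ((⊤ : Opens (E d)) : Set (E d)), w x * θ (x + -h) := by
    intro w θ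
    rw [← (measurePreserving_shift h).integral_comp (measurableEmbedding_addRight h)
      (fun x => w x * θ (x + -h))]
    refine integral_congr_ae ?_
    filter_upwards [Lp.coeFn_compMeasurePreserving w (measurePreserving_shift h)] with x hx
    rw [hx]
    simp
  have := huv _ hψ
  rw [multiDeriv_shift] at this
  rw [e, e, this]

/-- The translation `τ_h f(x) = f(x + h)` on `W^{k,p}(ℝ^d)`. -/
def translate [Fact (1 ≤ p)] (h : E d) (f : Sobolev (⊤ : Opens (E d)) k p) : Sobolev (⊤ : Opens (E d)) k p :=
  ⟨Lp.compMeasurePreserving _ (measurePreserving_shift h) f.toLp, fun _ hα =>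
    ⟨_, (Sobolev.hasWeakDeriv hα f).shift h⟩⟩

end Translation

section Conditions

variable {d : ℕ} {Ω : Opens (E d)} {k : ℕ} {p : ℝ≥0∞} [Fact (1 ≤ p)]

/-- `g ∈ W^{k,p}(ℝ^d)` is the extension of `f ∈ W^{k,p}(Ω)` by zero outside `Ω`. -/
def IsZeroExtension (f : Sobolev Ω k p) (g : Sobolev (⊤ : Opens (E d)) k p) : Prop :=
  g.toLp =ᵐ[volume] (Ω : Set (E d)).indicator f.toLp

/-- The family in `W^{k,p}(ℝ^d)` of the extensions by zero of the members of `F`. -/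
def zeroExtension (F : Set (Sobolev Ω k p)) : Set (Sobolev (⊤ : Opens (E d)) k p) :=
  {g | ∃ f ∈ F, IsZeroExtension f g}

/-- Boundedness in `W^{k,p}(Ω)`. -/
def SobolevBounded (F : Set (Sobolev Ω k p)) : Prop :=
  ∃ M : ℝ, 0 < M ∧ ∀ f ∈ F, ‖f‖ ≤ M

/-- Boundedness of `‖f‖_{L^p(Ω)} + ∑_{|α| = k} ‖D^α f‖_{L^p(Ω)}`. -/
def LowTopBounded (F : Set (Sobolev Ω k p)) : Prop :=
  ∃ M : ℝ, 0 < M ∧ ∀ f ∈ F, ‖f.toLp‖ + ∑ α ∈ multiIndicesEq d k, ‖f.weakDeriv α‖ ≤ M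

/-- Uniform continuity of translations in the norm of `W^{k,p}(ℝ^d)`. -/
def TranslationEquicontinuous (G : Set (Sobolev (⊤ : Opens (E d)) k p)) : Prop :=
  ∃ δ : ℝ → ℝ, (∀ ε, 0 < ε → 0 < δ ε) ∧
    ∀ g ∈ G, ∀ ε, 0 < ε → ∀ h : E d, ‖h‖ < δ ε → ‖translate h g - g‖ < ε

/-- Uniform continuity of translations in `L^p(ℝ^d)` of the derivatives `D^α f`, `|α| = k`,
extended by zero outside `Ω`. -/
def TopTranslationEquicontinuous (F : Set (Sobolev Ω k p)) : Prop :=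
  ∃ δ : ℝ → ℝ, (∀ ε, 0 < ε → 0 < δ ε) ∧
    ∀ f ∈ F, ∀ ε, 0 < ε → ∀ h : E d, ‖h‖ < δ ε →
      ∑ α ∈ multiIndicesEq d k,
        eLpNorm (fun x => (Ω : Set (E d)).indicator (f.weakDeriv α) (x + h) -
          (Ω : Set (E d)).indicator (f.weakDeriv α) x) p volume < ENNReal.ofReal ε

/-- Uniform smallness at infinity of `f` and its derivatives of order at most `k` on `ℝ^d`. -/
def SmallAtInfinity (G : Set (Sobolev (⊤ : Opens (E d)) k p)) : Prop :=
  ∃ A : ℝ → Set (E d), (∀ ε, 0 < ε → NullMeasurableSet (A ε) volume ∧ volume (A ε) < ⊤) ∧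
    ∀ g ∈ G, ∀ ε, 0 < ε →
      (∑ α ∈ multiIndicesLE d k, ∫ x in (A ε)ᶜ, |g.weakDeriv α x| ^ p.toReal) ^ (1 / p.toReal) < ε

/-- Relative compactness in the norm topology of `W^{k,p}(ℝ^d)`. -/
def SobolevPrecompact (G : Set (Sobolev (⊤ : Opens (E d)) k p)) : Prop :=
  IsCompact (closure G)

end Conditions

end SobolevCompactness

end

/-!
The compactness criterion holds for every family in `W^{k,p}(ℝ^d)`. The jet of the derivatives of
order at most `k` embeds `W^{k,p}` as a closed subspace of a finite power of `L^p`, so compactness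
may be tested on each derivative in `L^p(ℝ^d)`. There it is the Kolmogorov–Riesz theorem: uniformly
continuous translations make a function close to its means over the cells of a fine grid, and
smallness at infinity leaves only finitely many cells.

The reduction to the derivatives of order `k` uses that `Ω` is bounded in one direction `e_i`: a
test function `φ` on a slab of width `2R` satisfies `‖φ‖_p ≤ 2R ‖∂_i φ‖_p`, and iterating this
raises `D^α φ` to a derivative of order `k`. For `‖h‖ < 1` the difference `τ_h φ - φ` is again a
test function on a slab, of width `2(R + 1)`, so translations are controlled in the same way. Both
estimates pass to `W_0^{k,p}(Ω)` by density.
-/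

noncomputable section

namespace SobolevCompactness

section Calculus

variable {d : ℕ}

theorem contDiff_partialDeriv {φ : E d → ℝ} (hφ : ContDiff ℝ ∞ φ) (i : Fin d) :
    ContDiff ℝ ∞ (partialDeriv i φ) :=
  (hφ.fderiv_right (m := ∞) (by simp)).clm_apply contDiff_const

theorem partialDeriv_comm {φ : E d → ℝ} (hφ : ContDiff ℝ 2 φ) (i j : Fin d) :
    partialDeriv i (partialDeriv j φ) = partialDeriv j (partialDeriv i φ) := by
  have hdiff : Differentiable ℝ (fderiv ℝ φ) :=
    (hφ.fderiv_right (m := 1) (by norm_num)).differentiable one_ne_zero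
  have second_deriv (v w x : E d) :
      fderiv ℝ (fun y => fderiv ℝ φ y v) x w = fderiv ℝ (fderiv ℝ φ) x w v := by
    rw [fderiv_clm_apply (hdiff x) (differentiableAt_const v)]
    simp
  funext x
  unfold partialDeriv
  rw [second_deriv, second_deriv]
  exact hφ.contDiffAt.isSymmSndFDerivAt (by simp) _ _

theorem contDiff_iterate_partialDeriv {φ : E d → ℝ} (hφ : ContDiff ℝ ∞ φ) (i : Fin d) (n : ℕ) :
    ContDiff ℝ ∞ ((partialDeriv i)^[n] φ) :=
  Function.Iterate.rec (ContDiff ℝ ∞) hφ (fun _ h => contDiff_partialDeriv h i) n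

theorem partialDeriv_iterate_comm {φ : E d → ℝ} (hφ : ContDiff ℝ ∞ φ) (i j : Fin d) (n : ℕ) :
    partialDeriv i ((partialDeriv j)^[n] φ) = (partialDeriv j)^[n] (partialDeriv i φ) := by
  induction n with
  | zero => rfl
  | succ n ih =>
    rw [Function.iterate_succ_apply', Function.iterate_succ_apply', ← ih,
      partialDeriv_comm ((contDiff_iterate_partialDeriv hφ j n).of_le ENat.LEInfty.out)]

theorem contDiff_foldr_partialDeriv {φ : E d → ℝ} (hφ : ContDiff ℝ ∞ φ) (α : Fin d → ℕ)
    (l : List (Fin d)) :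
    ContDiff ℝ ∞ (l.foldr (fun i g => (partialDeriv i)^[α i] g) φ) := by
  induction l with
  | nil => exact hφ
  | cons i l ih => exact contDiff_iterate_partialDeriv ih i _

theorem contDiff_multiDeriv {φ : E d → ℝ} (hφ : ContDiff ℝ ∞ φ) (α : Fin d → ℕ) :
    ContDiff ℝ ∞ (multiDeriv α φ) :=
  contDiff_foldr_partialDeriv hφ α _

theorem foldr_partialDeriv_add_single {φ : E d → ℝ} (hφ : ContDiff ℝ ∞ φ) (α : Fin d → ℕ)
    (i : Fin d) {l : List (Fin d)} (hl : l.Nodup) :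
    l.foldr (fun j g => (partialDeriv j)^[(α + Pi.single i 1 : Fin d → ℕ) j] g) φ =
      if i ∈ l then partialDeriv i (l.foldr (fun j g => (partialDeriv j)^[α j] g) φ)
      else l.foldr (fun j g => (partialDeriv j)^[α j] g) φ := by
  induction l with
  | nil => simp
  | cons j l ih =>
    obtain ⟨hj, hl⟩ := List.nodup_cons.1 hl
    simp only [List.foldr_cons, ih hl, List.mem_cons]
    rcases eq_or_ne i j with rfl | hij
    · simp [hj, Function.iterate_succ_apply']
    · by_cases hi : i ∈ l
      · simp [hi, hij.symm,
          partialDeriv_iterate_comm (contDiff_foldr_partialDeriv hφ α l)]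
      · simp [hi, hij, hij.symm]

theorem multiDeriv_add_single {φ : E d → ℝ} (hφ : ContDiff ℝ ∞ φ) (α : Fin d → ℕ) (i : Fin d) :
    multiDeriv (α + Pi.single i 1) φ = partialDeriv i (multiDeriv α φ) := by
  simp only [multiDeriv, foldr_partialDeriv_add_single hφ α i (List.nodup_finRange d),
    List.mem_finRange, if_true]

@[elab_as_elim]
theorem multiIndex_induction {ι : Type*} [Finite ι] [DecidableEq ι] {P : (ι → ℕ) → Prop}
    (zero : P 0) (add_single : ∀ α i, P α → P (α + Pi.single i 1)) (α : ι → ℕ) : P α := by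
  induction α using WellFoundedLT.induction with
  | ind α ih =>
    rcases eq_or_ne α 0 with rfl | hα
    · exact zero
    obtain ⟨i, hi⟩ := Function.ne_iff.1 hα
    have hle : Pi.single i 1 ≤ α := fun j => by
      rcases eq_or_ne j i with rfl | hj
      · simpa [Nat.one_le_iff_ne_zero] using hi
      · simp [hj]
    have hlt : α - Pi.single i 1 < α :=
      Pi.lt_def.2 ⟨tsub_le_self, i, by simpa using Nat.pos_of_ne_zero hi⟩
    rw [← tsub_add_cancel_of_le hle]
    exact add_single _ i (ih _ hlt)

theorem partialDeriv_multiDeriv_comm {φ : E d → ℝ} (hφ : ContDiff ℝ ∞ φ) (i : Fin d)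
    (α : Fin d → ℕ) : partialDeriv i (multiDeriv α φ) = multiDeriv α (partialDeriv i φ) := by
  induction α using multiIndex_induction with
  | zero => simp only [multiDeriv_zero]
  | add_single α j ih =>
    rw [multiDeriv_add_single hφ, multiDeriv_add_single (contDiff_partialDeriv hφ i), ← ih,
      partialDeriv_comm ((contDiff_multiDeriv hφ α).of_le ENat.LEInfty.out)]

theorem partialDeriv_sub {φ ψ : E d → ℝ} (hφ : Differentiable ℝ φ) (hψ : Differentiable ℝ ψ)
    (i : Fin d) : partialDeriv i (φ - ψ) = partialDeriv i φ - partialDeriv i ψ := by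
  funext x
  simp only [partialDeriv, Pi.sub_apply, fderiv_sub (hφ x) (hψ x), sub_apply]

theorem multiDeriv_sub {φ ψ : E d → ℝ} (hφ : ContDiff ℝ ∞ φ) (hψ : ContDiff ℝ ∞ ψ)
    (α : Fin d → ℕ) : multiDeriv α (φ - ψ) = multiDeriv α φ - multiDeriv α ψ := by
  induction α using multiIndex_induction with
  | zero => simp only [multiDeriv_zero]
  | add_single α i ih =>
    rw [multiDeriv_add_single (φ := φ - ψ) (hφ.sub hψ), ih, multiDeriv_add_single hφ,
      multiDeriv_add_single hψ,
      partialDeriv_sub ((contDiff_multiDeriv hφ α).differentiable (by simp))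
        ((contDiff_multiDeriv hψ α).differentiable (by simp))]

theorem integrable_mul_of_hasCompactSupport {u φ : E d → ℝ} (hu : Continuous u)
    (hc : HasCompactSupport u) (hφ : Continuous φ) : Integrable (fun x => u x * φ x) :=
  (hu.mul hφ).integrable_of_hasCompactSupport hc.mul_right

theorem integral_mul_partialDeriv {u φ : E d → ℝ} (hu : ContDiff ℝ ∞ u)
    (hc : HasCompactSupport u) (hφ : ContDiff ℝ ∞ φ) (i : Fin d) :
    ∫ x, u x * partialDeriv i φ x = - ∫ x, partialDeriv i u x * φ x :=
  integral_mul_fderiv_eq_neg_fderiv_mul_of_integrable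
    (integrable_mul_of_hasCompactSupport (contDiff_partialDeriv hu i).continuous
      (hc.fderiv_apply ℝ _) hφ.continuous)
    (integrable_mul_of_hasCompactSupport hu.continuous hc (contDiff_partialDeriv hφ i).continuous)
    (integrable_mul_of_hasCompactSupport hu.continuous hc hφ.continuous)
    (fun x _ => hu.differentiable (by simp) x) (fun x _ => hφ.differentiable (by simp) x)

theorem integral_mul_multiDeriv {u φ : E d → ℝ} (hu : ContDiff ℝ ∞ u)
    (hc : HasCompactSupport u) (hφ : ContDiff ℝ ∞ φ) (α : Fin d → ℕ) :
    ∫ x, u x * multiDeriv α φ x = (-1) ^ (∑ i, α i) * ∫ x, multiDeriv α u x * φ x := by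
  induction α using multiIndex_induction generalizing u with
  | zero => simp [multiDeriv_zero]
  | add_single α i ih =>
    rw [multiDeriv_add_single hφ, integral_mul_partialDeriv hu hc (contDiff_multiDeriv hφ α),
      ih (contDiff_partialDeriv hu i) (hc.fderiv_apply ℝ _), ← partialDeriv_multiDeriv_comm hu,
      ← multiDeriv_add_single hu]
    simp [Finset.sum_add_distrib, pow_succ]

end Calculus

section Poincare

theorem eLpNorm_rpow_toReal {X F : Type*} [MeasurableSpace X] {μ : Measure X}
    [NormedAddCommGroup F] {p : ℝ≥0∞} (h1 : 1 ≤ p) (hp : p ≠ ⊤) (f : X → F) :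
    eLpNorm f p μ ^ p.toReal = ∫⁻ x, ‖f x‖ₑ ^ p.toReal ∂μ := by
  lift p to NNReal using hp
  exact eLpNorm_nnreal_pow_eq_lintegral (by rintro rfl; simp at h1)

theorem enorm_integral_le_eLpNorm {X F : Type*} [MeasurableSpace X] {μ : Measure X}
    [IsProbabilityMeasure μ] [NormedAddCommGroup F] [NormedSpace ℝ F] {p : ℝ≥0∞} (h1 : 1 ≤ p)
    {f : X → F} (hf : AEStronglyMeasurable f μ) : ‖∫ x, f x ∂μ‖ₑ ≤ eLpNorm f p μ :=
  calc ‖∫ x, f x ∂μ‖ₑ ≤ eLpNorm f 1 μ := by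
        rw [eLpNorm_one_eq_lintegral_enorm]; exact enorm_integral_le_lintegral_enorm f
    _ ≤ eLpNorm f p μ := eLpNorm_le_eLpNorm_of_exponent_le h1 hf

theorem enorm_integral_rpow_le {X F : Type*} [MeasurableSpace X] {μ : Measure X}
    [IsProbabilityMeasure μ] [NormedAddCommGroup F] [NormedSpace ℝ F] {p : ℝ≥0∞} (h1 : 1 ≤ p)
    (hp : p ≠ ⊤) {f : X → F} (hf : AEStronglyMeasurable f μ) :
    ‖∫ x, f x ∂μ‖ₑ ^ p.toReal ≤ ∫⁻ x, ‖f x‖ₑ ^ p.toReal ∂μ := by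
  rw [← eLpNorm_rpow_toReal h1 hp]
  gcongr
  exact enorm_integral_le_eLpNorm h1 hf

section Direction

variable {V F : Type*} [NormedAddCommGroup V] [NormedSpace ℝ V] [NormedAddCommGroup F]
  [NormedSpace ℝ F] [CompleteSpace F] {p : ℝ≥0∞}

theorem enorm_rpow_le_lintegral_fderiv (h1 : 1 ≤ p) (hp : p ≠ ⊤) {u : V → F}
    (hu : ContDiff ℝ 1 u) {h x : V} (hx : u x ≠ 0 → u (x + h) = 0) :
    ‖u x‖ₑ ^ p.toReal ≤
      ∫⁻ s in Set.Ioc (0 : ℝ) 1, ‖fderiv ℝ u (x + s • h) h‖ₑ ^ p.toReal := by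
  by_cases hux : u x = 0
  · simp [hux, ENNReal.toReal_pos (zero_lt_one.trans_le h1).ne' hp]
  have hderiv (s : ℝ) : HasDerivAt (fun s : ℝ => u (x + s • h)) (fderiv ℝ u (x + s • h) h) s := by
    have hline : HasDerivAt (fun s : ℝ => x + s • h) h s := by
      simpa using ((hasDerivAt_id s).smul_const h).const_add x
    exact (hu.differentiable one_ne_zero _).hasFDerivAt.comp_hasDerivAt s hline
  have hcont : Continuous fun s : ℝ => fderiv ℝ u (x + s • h) h := by
    have := hu.continuous_fderiv one_ne_zero
    fun_prop
  have hint : ∫ s in Set.Ioc (0 : ℝ) 1, fderiv ℝ u (x + s • h) h = -u x := by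
    rw [← intervalIntegral.integral_of_le zero_le_one,
      intervalIntegral.integral_eq_sub_of_hasDerivAt (fun s _ => hderiv s)
        (hcont.intervalIntegrable 0 1)]
    simp [hx hux]
  have : IsProbabilityMeasure (volume.restrict (Set.Ioc (0 : ℝ) 1)) := ⟨by simp⟩
  rw [← enorm_neg, ← hint]
  exact enorm_integral_rpow_le h1 hp hcont.aestronglyMeasurable

variable [MeasurableSpace V] [BorelSpace V] {μ : Measure V} [SFinite μ] [μ.IsAddRightInvariant]

theorem eLpNorm_le_eLpNorm_fderiv_apply (h1 : 1 ≤ p) (hp : p ≠ ⊤) {u : V → F}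
    (hu : ContDiff ℝ 1 u) {h : V} (hh : ∀ x, u x ≠ 0 → u (x + h) = 0) :
    eLpNorm u p μ ≤ eLpNorm (fun x => fderiv ℝ u x h) p μ := by
  have hp0 : p ≠ 0 := (zero_lt_one.trans_le h1).ne'
  have hcont : Continuous fun q : V × ℝ => fderiv ℝ u (q.1 + q.2 • h) h := by
    have := hu.continuous_fderiv one_ne_zero
    fun_prop
  rw [eLpNorm_eq_lintegral_rpow_enorm_toReal hp0 hp, eLpNorm_eq_lintegral_rpow_enorm_toReal hp0 hp]
  gcongr ?_ ^ _
  calc ∫⁻ x, ‖u x‖ₑ ^ p.toReal ∂μ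
      ≤ ∫⁻ x, ∫⁻ s in Set.Ioc (0 : ℝ) 1, ‖fderiv ℝ u (x + s • h) h‖ₑ ^ p.toReal ∂volume ∂μ :=
        lintegral_mono fun x => enorm_rpow_le_lintegral_fderiv h1 hp hu (hh x)
    _ = ∫⁻ s in Set.Ioc (0 : ℝ) 1, ∫⁻ x, ‖fderiv ℝ u (x + s • h) h‖ₑ ^ p.toReal ∂μ :=
        lintegral_lintegral_swap (hcont.enorm.measurable.pow_const _).aemeasurable
    _ = ∫⁻ _ in Set.Ioc (0 : ℝ) 1, ∫⁻ x, ‖fderiv ℝ u x h‖ₑ ^ p.toReal ∂μ :=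
        lintegral_congr fun s =>
          lintegral_add_right_eq_self (fun x => ‖fderiv ℝ u x h‖ₑ ^ p.toReal) (s • h)
    _ = ∫⁻ x, ‖fderiv ℝ u x h‖ₑ ^ p.toReal ∂μ := by simp

end Direction

variable {d : ℕ} {p : ℝ≥0∞}

/-- The slab of half-width `R` around the hyperplane `x i = 0`. -/
def slab (i : Fin d) (R : ℝ) : Opens (E d) where
  carrier := {x | |x i| < R}
  is_open' := isOpen_lt (by fun_prop) continuous_const

theorem mem_slab {i : Fin d} {R : ℝ} {x : E d} : x ∈ slab i R ↔ |x i| < R := Iff.rfl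

theorem eLpNorm_le_eLpNorm_partialDeriv (h1 : 1 ≤ p) (hp : p ≠ ⊤) {i : Fin d} {R : ℝ} (hR : 0 ≤ R)
    {u : E d → ℝ} (hu : IsTestFunction (slab i R) u) :
    eLpNorm u p volume ≤ ENNReal.ofReal (2 * R) * eLpNorm (partialDeriv i u) p volume := by
  have hvanish (x : E d) (hx : u x ≠ 0) : u (x + (2 * R) • EuclideanSpace.single i 1) = 0 := by
    by_contra hne
    have hxi : |x i| < R := hu.subset (subset_tsupport _ hx)
    have hxi' : |x i + 2 * R| < R := by
      simpa using mem_slab.1 (hu.subset (subset_tsupport _ hne))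
    linarith [(abs_lt.1 hxi).1, (abs_lt.1 hxi').2]
  calc eLpNorm u p volume
      ≤ eLpNorm (fun x => fderiv ℝ u x ((2 * R) • EuclideanSpace.single i 1)) p volume :=
        eLpNorm_le_eLpNorm_fderiv_apply h1 hp (hu.smooth.of_le ENat.LEInfty.out) hvanish
    _ = eLpNorm ((2 * R) • partialDeriv i u) p volume := by
        congr 1; funext x; exact map_smul _ _ _
    _ = ENNReal.ofReal (2 * R) * eLpNorm (partialDeriv i u) p volume := by
        rw [eLpNorm_const_smul, Real.enorm_eq_ofReal (by positivity)]

theorem eLpNorm_multiDeriv_le (h1 : 1 ≤ p) (hp : p ≠ ⊤) {i : Fin d} {R : ℝ} (hR : 0 ≤ R)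
    {u : E d → ℝ} (hu : IsTestFunction (slab i R) u) (α : Fin d → ℕ) (n : ℕ) :
    eLpNorm (multiDeriv α u) p volume ≤
      ENNReal.ofReal (2 * R) ^ n * eLpNorm (multiDeriv (α + n • Pi.single i 1) u) p volume := by
  induction n with
  | zero => simp
  | succ n ih =>
    refine ih.trans ?_
    rw [pow_succ, mul_assoc, succ_nsmul, ← add_assoc, multiDeriv_add_single hu.smooth]
    gcongr
    exact eLpNorm_le_eLpNorm_partialDeriv h1 hp hR (hu.multiDeriv _)

end Poincare

section KolmogorovRiesz

theorem tendsto_measure_inter_preimage_compl_finset {X ι : Type*} [MeasurableSpace X]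
    {μ : Measure X} [Countable ι] [MeasurableSpace ι] [DiscreteMeasurableSpace ι] {g : X → ι}
    (hg : Measurable g) {A : Set X} (hA : MeasurableSet A) (hμA : μ A ≠ ⊤) :
    Filter.Tendsto (fun S : Finset ι => μ (A ∩ g ⁻¹' (S : Set ι)ᶜ)) Filter.atTop (nhds 0) := by
  have hempty : ⋂ S : Finset ι, A ∩ g ⁻¹' (S : Set ι)ᶜ = ∅ :=
    Set.eq_empty_of_forall_notMem fun x hx =>
      (Set.mem_iInter.1 hx {g x}).2 (Finset.mem_coe.2 (Finset.mem_singleton_self _))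
  rw [← measure_empty (μ := μ), ← hempty]
  refine tendsto_measure_iInter_atTop
    (fun S => (hA.inter (hg (MeasurableSet.of_discrete))).nullMeasurableSet) ?_
    ⟨∅, measure_ne_top_of_subset Set.inter_subset_left hμA⟩
  exact fun S T hST => Set.inter_subset_inter_right A (Set.preimage_mono
    (Set.compl_subset_compl.2 (Finset.coe_subset.2 hST)))

theorem exists_finset_mul_measure_rpow_le {X ι : Type*} [MeasurableSpace X]
    {μ : Measure X} [Countable ι] [MeasurableSpace ι] [DiscreteMeasurableSpace ι] {g : X → ι}
    (hg : Measurable g) {A : Set X} (hA : MeasurableSet A) (hμA : μ A ≠ ⊤) {b ε : ℝ≥0∞}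
    (hb : b ≠ ⊤) (hε : 0 < ε) {q : ℝ} (hq : 0 < q) :
    ∃ S : Finset ι, b * μ (A ∩ (g ⁻¹' S)ᶜ) ^ q ≤ ε := by
  have hlim : Filter.Tendsto (fun S : Finset ι => b * μ (A ∩ g ⁻¹' (S : Set ι)ᶜ) ^ q)
      Filter.atTop (nhds 0) := by
    simpa [hq] using ENNReal.Tendsto.const_mul (a := b)
      ((tendsto_measure_inter_preimage_compl_finset hg hA hμA).ennrpow_const q) (Or.inr hb)
  exact (hlim.eventually_le_const hε).exists

theorem coeFn_sum_smul_indicatorConstLp_preimage {X ι : Type*} [MeasurableSpace X]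
    {μ : Measure X} {p : ℝ≥0∞} {g : X → ι} (hg : ∀ n, MeasurableSet (g ⁻¹' {n}))
    (hμ : ∀ n, μ (g ⁻¹' {n}) ≠ ⊤) (S : Finset ι) (m : ι → ℝ) :
    (∑ n : S, m n • indicatorConstLp p (hg n) (hμ n) (1 : ℝ) : Lp ℝ p μ) =ᵐ[μ]
      (g ⁻¹' S).indicator fun x => m (g x) := by
  classical
  have hterm : ∀ᵐ x ∂μ, ∀ n : S, (m n • indicatorConstLp p (hg n) (hμ n) (1 : ℝ) : Lp ℝ p μ) x =
      if g x = n then m n else 0 := by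
    refine ae_all_iff.2 fun n => ?_
    filter_upwards [Lp.coeFn_smul (m n) (indicatorConstLp p (hg n) (hμ n) (1 : ℝ)),
      indicatorConstLp_coeFn (p := p) (hs := hg n) (hμs := hμ n) (c := (1 : ℝ))] with x hx hx'
    rw [hx, Pi.smul_apply, hx', Set.indicator_apply]
    simp
  filter_upwards [hterm, Lp.coeFn_fun_finsetSum Finset.univ
    (fun n : S => m n • indicatorConstLp p (hg n) (hμ n) (1 : ℝ))] with x hx hsum
  rw [hsum, Finset.sum_congr rfl fun n _ => hx n,
    Finset.sum_coe_sort S fun n => if g x = n then m n else 0, Finset.sum_ite_eq,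
    Set.indicator_apply]
  simp only [Set.mem_preimage, Finset.mem_coe]

theorem eLpNorm_sub_indicator_le {X F : Type*} [MeasurableSpace X] {μ : Measure X}
    [NormedAddCommGroup F] {p : ℝ≥0∞} (h1 : 1 ≤ p) (hp : p ≠ ⊤) {f m : X → F}
    (hf : AEStronglyMeasurable f μ) (hm : AEStronglyMeasurable m μ) {A U : Set X}
    (hA : MeasurableSet A) (hU : MeasurableSet U) {b : ℝ} (hmb : ∀ x, ‖m x‖ ≤ b) :
    eLpNorm (f - U.indicator m) p μ ≤
      eLpNorm (f - m) p μ + eLpNorm (Aᶜ.indicator f) p μ +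
        ENNReal.ofReal b * μ (A ∩ Uᶜ) ^ (1 / p.toReal) := by
  classical
  have hpointwise (x : X) : ‖(f - U.indicator m) x‖ ≤
      (fun x => ‖(f - m) x‖ + ‖Aᶜ.indicator f x‖ + (A ∩ Uᶜ).indicator (fun _ => b) x) x := by
    have hfm : ‖f x‖ ≤ ‖f x - m x‖ + b := by
      linarith [norm_le_norm_sub_add (f x) (m x), hmb x]
    have : 0 ≤ b := (norm_nonneg _).trans (hmb x)
    by_cases hxU : x ∈ U <;> by_cases hxA : x ∈ A <;> simp [hxU, hxA, hfm]
  have hconst : eLpNorm ((A ∩ Uᶜ).indicator fun _ => b) p μ ≤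
      ENNReal.ofReal b * μ (A ∩ Uᶜ) ^ (1 / p.toReal) := by
    rcases isEmpty_or_nonempty X with hX | ⟨⟨x⟩⟩
    · simp [Measure.eq_zero_of_isEmpty]
    rw [eLpNorm_indicator_const (hA.inter hU.compl) (zero_lt_one.trans_le h1).ne' hp,
      Real.enorm_eq_ofReal ((norm_nonneg _).trans (hmb x))]
  have hfm := (hf.sub hm).norm
  have hfA := (hf.indicator hA.compl).norm
  refine (eLpNorm_mono_real hpointwise).trans ?_
  refine (eLpNorm_add_le (hfm.add hfA)
    (aestronglyMeasurable_const.indicator (hA.inter hU.compl)) h1).trans ?_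
  gcongr
  refine (eLpNorm_add_le hfm hfA h1).trans ?_
  rw [eLpNorm_norm, eLpNorm_norm]

theorem totallyBounded_of_forall_exists_isCompact {X : Type*} [PseudoMetricSpace X] {K : Set X}
    (h : ∀ ε > 0, ∃ C : Set X, IsCompact C ∧ ∀ x ∈ K, ∃ y ∈ C, dist x y ≤ ε) :
    TotallyBounded K := by
  rw [Metric.totallyBounded_iff]
  intro ε hε
  obtain ⟨C, hC, hK⟩ := h (ε / 2) (half_pos hε)
  obtain ⟨t, ht, hCt⟩ := Metric.totallyBounded_iff.1 hC.totallyBounded (ε / 2) (half_pos hε)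
  refine ⟨t, ht, fun x hx => ?_⟩
  obtain ⟨y, hy, hxy⟩ := hK x hx
  obtain ⟨z, hz, hyz⟩ := Set.mem_iUnion₂.1 (hCt hy)
  refine Set.mem_iUnion₂.2 ⟨z, hz, ?_⟩
  rw [Metric.mem_ball] at hyz ⊢
  linarith [dist_triangle x y z]

variable {d : ℕ}

/-- The index of the cell of the cubical grid of width `r` which contains `x`. -/
def gridIndex (r : ℝ) (x : E d) : Fin d → ℤ := fun i => ⌊x i / r⌋

/-- The cell of the cubical grid of width `r` with index `n`. -/
def gridCell (r : ℝ) (n : Fin d → ℤ) : Set (E d) := gridIndex r ⁻¹' {n}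

/-- The open cube of half-width `r` around `0`, which contains the differences of any two points
of a cell of the grid of width `r`. -/
def centeredCube (d : ℕ) (r : ℝ) : Set (E d) := WithLp.ofLp ⁻¹' Metric.ball (0 : Fin d → ℝ) r

theorem measurable_gridIndex (r : ℝ) : Measurable (gridIndex r : E d → Fin d → ℤ) :=
  measurable_pi_lambda _ fun i => Int.measurable_floor.comp (by fun_prop)

theorem measurableSet_gridCell (r : ℝ) (n : Fin d → ℤ) : MeasurableSet (gridCell r n) :=
  measurable_gridIndex r (MeasurableSet.singleton n)

theorem measurableSet_centeredCube (r : ℝ) : MeasurableSet (centeredCube d r) :=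
  (PiLp.volume_preserving_ofLp (Fin d)).measurable Metric.isOpen_ball.measurableSet

theorem exists_centeredCube_subset_ball {δ : ℝ} (hδ : 0 < δ) :
    ∃ r : ℝ, 0 < r ∧ centeredCube d r ⊆ Metric.ball 0 δ := by
  have hcont : Continuous (WithLp.toLp 2 : (Fin d → ℝ) → E d) := PiLp.continuous_toLp 2 _
  obtain ⟨r, hr, h⟩ := Metric.continuousAt_iff.1 (hcont.continuousAt (x := 0)) δ hδ
  exact ⟨r, hr, fun z hz => by simpa using h (x := WithLp.ofLp z) hz⟩

/-- The mean of `f` over a cell of the grid of width `r`. -/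
def cellMean (r : ℝ) (f : E d → ℝ) (n : Fin d → ℤ) : ℝ := ⨍ y in gridCell r n, f y

variable {r : ℝ} (hr : 0 < r)
include hr

theorem volume_gridCell (n : Fin d → ℤ) : volume (gridCell r n) = ENNReal.ofReal r ^ d := by
  have hcell : gridCell r n = WithLp.ofLp ⁻¹'
      (Set.univ.pi fun i => Set.Ico ((n i : ℝ) * r) ((n i : ℝ) * r + r)) := by
    ext x
    simp only [gridCell, gridIndex, Set.mem_preimage, Set.mem_singleton_iff, funext_iff,
      Int.floor_eq_iff, Set.mem_univ_pi, Set.mem_Ico, le_div_iff₀ hr, div_lt_iff₀ hr, add_mul,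
      one_mul]
  rw [hcell, (PiLp.volume_preserving_ofLp (Fin d)).measure_preimage
    (MeasurableSet.univ_pi fun i => measurableSet_Ico).nullMeasurableSet, Real.volume_pi_Ico]
  simp

theorem volume_centeredCube : volume (centeredCube d r) = 2 ^ d * ENNReal.ofReal r ^ d := by
  rw [centeredCube, (PiLp.volume_preserving_ofLp (Fin d)).measure_preimage
    Metric.isOpen_ball.measurableSet.nullMeasurableSet, Real.volume_pi_ball _ hr, Fintype.card_fin,
    ENNReal.ofReal_pow (by positivity), ENNReal.ofReal_mul (by positivity), mul_pow]
  simp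

theorem sub_mem_centeredCube {x y : E d} (h : gridIndex r y = gridIndex r x) :
    y - x ∈ centeredCube d r := by
  rw [centeredCube, Set.mem_preimage, mem_ball_zero_iff, pi_norm_lt_iff hr]
  intro i
  have hfloor := Int.abs_sub_lt_one_of_floor_eq_floor (congrFun h i)
  rw [← sub_div, abs_div, abs_of_pos hr, div_lt_one hr] at hfloor
  simpa using hfloor

variable {p : ℝ≥0∞} {f : E d → ℝ}

theorem isProbabilityMeasure_gridCell (n : Fin d → ℤ) :
    IsProbabilityMeasure
      ((volume.restrict (gridCell r n) Set.univ)⁻¹ • (volume.restrict (gridCell r n))) := by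
  have hfinite : IsFiniteMeasure (volume.restrict (gridCell r n)) :=
    ⟨by rw [Measure.restrict_apply_univ, volume_gridCell hr]; finiteness⟩
  have hne : NeZero (volume.restrict (gridCell r n)) :=
    ⟨by rw [Ne, Measure.restrict_eq_zero, volume_gridCell hr]; simp [hr]⟩
  infer_instance

theorem enorm_cellMean_le (h1 : 1 ≤ p) (hp : p ≠ ⊤) (hf : AEStronglyMeasurable f volume)
    (n : Fin d → ℤ) :
    ‖cellMean r f n‖ₑ ≤ (ENNReal.ofReal r ^ d)⁻¹ ^ (1 / p).toReal * eLpNorm f p volume := by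
  have := isProbabilityMeasure_gridCell hr n
  refine (enorm_integral_le_eLpNorm h1 (hf.restrict.smul_measure _)).trans ?_
  rw [eLpNorm_smul_measure_of_ne_top hp, Measure.restrict_apply_univ, volume_gridCell hr,
    smul_eq_mul]
  gcongr
  exact Measure.restrict_le_self

theorem enorm_sub_cellMean_rpow_le (h1 : 1 ≤ p) (hp : p ≠ ⊤) (hf : MemLp f p volume) (x : E d) :
    ‖f x - cellMean r f (gridIndex r x)‖ₑ ^ p.toReal ≤
      (ENNReal.ofReal r ^ d)⁻¹ *
        ∫⁻ z in centeredCube d r, ‖f (x + z) - f x‖ₑ ^ p.toReal := by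
  have := isProbabilityMeasure_gridCell hr (gridIndex r x)
  set C := gridCell r (gridIndex r x)
  set μ : Measure (E d) := (volume.restrict C Set.univ)⁻¹ • volume.restrict C with hμ
  have hvol : volume.restrict C Set.univ = ENNReal.ofReal r ^ d := by
    rw [Measure.restrict_apply_univ, volume_gridCell hr]
  have hint : Integrable f μ :=
    ((hf.restrict C).smul_measure (by rw [hvol]; simp [hr])).integrable h1
  have hmean : ∫ y, (f y - f x) ∂μ = cellMean r f (gridIndex r x) - f x := by
    rw [integral_sub hint (integrable_const _), integral_const, probReal_univ, one_smul]
    rfl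
  calc ‖f x - cellMean r f (gridIndex r x)‖ₑ ^ p.toReal
      ≤ ∫⁻ y, ‖f y - f x‖ₑ ^ p.toReal ∂μ := by
        rw [enorm_sub_rev, ← hmean]
        exact enorm_integral_rpow_le h1 hp (hint.1.sub aestronglyMeasurable_const)
    _ = (ENNReal.ofReal r ^ d)⁻¹ * ∫⁻ y in C, ‖f y - f x‖ₑ ^ p.toReal := by
        rw [hμ, lintegral_smul_measure, hvol, smul_eq_mul]
    _ ≤ (ENNReal.ofReal r ^ d)⁻¹ *
        ∫⁻ z in centeredCube d r, ‖f (x + z) - f x‖ₑ ^ p.toReal := by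
        refine mul_le_mul_right ?_ _
        have hC : MeasurableSet C := measurableSet_gridCell r _
        rw [← lintegral_indicator hC, ← lintegral_indicator (measurableSet_centeredCube r),
          ← lintegral_add_left_eq_self _ x]
        refine lintegral_mono fun z => ?_
        by_cases hz : x + z ∈ C
        · have hz' : z ∈ centeredCube d r := by simpa using sub_mem_centeredCube hr hz
          simp [hz, hz']
        · simp [hz]

theorem eLpNorm_sub_cellMean_rpow_le (h1 : 1 ≤ p) (hp : p ≠ ⊤) (hf : StronglyMeasurable f)
    (hfp : MemLp f p volume) {c : ℝ≥0∞}
    (hc : ∀ z ∈ centeredCube d r, eLpNorm (fun x => f (x + z) - f x) p volume ≤ c) :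
    eLpNorm (fun x => f x - cellMean r f (gridIndex r x)) p volume ^ p.toReal ≤
      2 ^ d * c ^ p.toReal := by
  have := hf.measurable
  have hmeas : Measurable fun q : E d × E d => ‖f (q.1 + q.2) - f q.1‖ₑ ^ p.toReal := by
    fun_prop
  calc eLpNorm (fun x => f x - cellMean r f (gridIndex r x)) p volume ^ p.toReal
      = ∫⁻ x, ‖f x - cellMean r f (gridIndex r x)‖ₑ ^ p.toReal := eLpNorm_rpow_toReal h1 hp _
    _ ≤ ∫⁻ x, (ENNReal.ofReal r ^ d)⁻¹ *
        ∫⁻ z in centeredCube d r, ‖f (x + z) - f x‖ₑ ^ p.toReal :=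
        lintegral_mono fun x => enorm_sub_cellMean_rpow_le hr h1 hp hfp x
    _ = (ENNReal.ofReal r ^ d)⁻¹ *
        ∫⁻ z in centeredCube d r, ∫⁻ x, ‖f (x + z) - f x‖ₑ ^ p.toReal := by
        rw [lintegral_const_mul' _ _ (by simp [hr]), lintegral_lintegral_swap hmeas.aemeasurable]
    _ ≤ (ENNReal.ofReal r ^ d)⁻¹ * ∫⁻ _ in centeredCube d r, c ^ p.toReal := by
        refine mul_le_mul_right ?_ _
        refine setLIntegral_mono measurable_const fun z hz => ?_
        rw [← eLpNorm_rpow_toReal h1 hp]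
        gcongr
        exact hc z hz
    _ = (ENNReal.ofReal r ^ d)⁻¹ * ENNReal.ofReal r ^ d * (2 ^ d * c ^ p.toReal) := by
        rw [setLIntegral_const, volume_centeredCube hr]
        ring
    _ = 2 ^ d * c ^ p.toReal := by
        rw [ENNReal.inv_mul_cancel (by simp [hr]) (by finiteness), one_mul]

theorem eLpNorm_sub_cellMean_le (h1 : 1 ≤ p) (hp : p ≠ ⊤) (hf : StronglyMeasurable f)
    (hfp : MemLp f p volume) {c : ℝ≥0∞}
    (hc : ∀ z ∈ centeredCube d r, eLpNorm (fun x => f (x + z) - f x) p volume ≤ c) :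
    eLpNorm (fun x => f x - cellMean r f (gridIndex r x)) p volume ≤ 2 ^ d * c := by
  have hp1 : 1 ≤ p.toReal := by simpa using ENNReal.toReal_mono hp h1
  rw [← ENNReal.rpow_le_rpow_iff (zero_lt_one.trans_le hp1),
    ENNReal.mul_rpow_of_nonneg _ _ (by positivity)]
  refine (eLpNorm_sub_cellMean_rpow_le hr h1 hp hf hfp hc).trans ?_
  gcongr
  simpa using ENNReal.rpow_le_rpow_of_exponent_le (one_le_pow₀ one_le_two : 1 ≤ (2 : ℝ≥0∞) ^ d) hp1

theorem eLpNorm_sub_indicator_cellMean_le (h1 : 1 ≤ p) (hp : p ≠ ⊤) (hf : StronglyMeasurable f)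
    (hfp : MemLp f p volume) {c : ℝ≥0∞}
    (hc : ∀ z ∈ centeredCube d r, eLpNorm (fun x => f (x + z) - f x) p volume ≤ c)
    {A : Set (E d)} (hA : MeasurableSet A) (hAc : eLpNorm (Aᶜ.indicator f) p volume ≤ c)
    {b : ℝ} (hb : ∀ n, ‖cellMean r f n‖ ≤ b) {S : Finset (Fin d → ℤ)}
    (hS : ENNReal.ofReal b * volume (A ∩ (gridIndex r ⁻¹' S)ᶜ) ^ (1 / p.toReal) ≤ c) :
    eLpNorm (f - (gridIndex r ⁻¹' S).indicator fun x => cellMean r f (gridIndex r x)) p volume ≤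
      (2 ^ d + 2) * c := by
  have hstep : StronglyMeasurable fun x => cellMean r f (gridIndex r x) :=
    (StronglyMeasurable.of_discrete (f := cellMean r f)).comp_measurable (measurable_gridIndex r)
  calc eLpNorm (f - (gridIndex r ⁻¹' S).indicator fun x => cellMean r f (gridIndex r x)) p volume
      ≤ 2 ^ d * c + c + c :=
        (eLpNorm_sub_indicator_le h1 hp hf.aestronglyMeasurable hstep.aestronglyMeasurable hA
          (measurable_gridIndex r MeasurableSet.of_discrete) fun x => hb _).trans
          (add_le_add (add_le_add (eLpNorm_sub_cellMean_le hr h1 hp hf hfp hc) hAc) hS)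
    _ = (2 ^ d + 2) * c := by ring

theorem exists_norm_cellMean_le [Fact (1 ≤ p)] (hp : p ≠ ⊤) (M : ℝ) :
    ∃ b : ℝ, ∀ f : Lp ℝ p (volume : Measure (E d)), ‖f‖ ≤ M → ∀ n, ‖cellMean r f n‖ ≤ b := by
  refine ⟨((ENNReal.ofReal r ^ d)⁻¹ ^ (1 / p).toReal * ENNReal.ofReal M).toReal,
    fun f hf n => ?_⟩
  rw [← toReal_enorm]
  refine ENNReal.toReal_mono (by finiteness)
    ((enorm_cellMean_le hr Fact.out hp (Lp.memLp f).1 n).trans ?_)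
  gcongr
  rw [← Lp.enorm_def, ← ofReal_norm]
  exact ENNReal.ofReal_le_ofReal hf

theorem exists_isCompact_stepFunctions [Fact (1 ≤ p)] (b : ℝ) (S : Finset (Fin d → ℤ)) :
    ∃ C : Set (Lp ℝ p (volume : Measure (E d))), IsCompact C ∧
      ∀ m : (Fin d → ℤ) → ℝ, (∀ n, ‖m n‖ ≤ b) → ∃ g ∈ C,
        g =ᵐ[volume] (gridIndex r ⁻¹' S).indicator fun x => m (gridIndex r x) := by
  have hfinite (n : Fin d → ℤ) : volume (gridCell r n) ≠ ⊤ := by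
    rw [volume_gridCell hr]; finiteness
  let step : (S → ℝ) → Lp ℝ p (volume : Measure (E d)) := fun v =>
    ∑ n, v n • indicatorConstLp p (measurableSet_gridCell r n) (hfinite n) (1 : ℝ)
  have hstep : Continuous step := by fun_prop
  refine ⟨step '' Metric.closedBall 0 |b|, (isCompact_closedBall _ _).image hstep, fun m hm =>
    ⟨step fun n => m n, ⟨_, ?_, rfl⟩,
      coeFn_sum_smul_indicatorConstLp_preimage (measurableSet_gridCell r) hfinite S m⟩⟩
  rw [mem_closedBall_zero_iff, pi_norm_le_iff_of_nonneg (abs_nonneg b)]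
  exact fun n => (hm n).trans (le_abs_self b)

omit hr in
theorem totallyBounded_of_translation_equicontinuous [Fact (1 ≤ p)] (hp : p ≠ ⊤)
    {μ : Measure (E d)} (hμ : μ = volume) {K : Set (Lp ℝ p μ)} {M : ℝ} (hM : ∀ f ∈ K, ‖f‖ ≤ M)
    (hequi : ∀ ε > 0, ∃ δ > 0, ∀ f ∈ K, ∀ h : E d, ‖h‖ < δ →
      eLpNorm (fun x => f (x + h) - f x) p volume ≤ ENNReal.ofReal ε)
    (htight : UnifTight (fun f : K => (f : E d → ℝ)) p volume) :
    TotallyBounded K := by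
  subst hμ
  have h1 : 1 ≤ p := Fact.out
  refine totallyBounded_of_forall_exists_isCompact fun ε hε => ?_
  set η := ε / (2 ^ d + 2) with hη
  have hη0 : 0 < η := by positivity
  obtain ⟨δ, hδ, hδK⟩ := hequi η hη0
  obtain ⟨r, hr, hrδ⟩ := exists_centeredCube_subset_ball (d := d) hδ
  obtain ⟨A, hA, hAfin, hAK⟩ :=
    htight.exists_measurableSet_indicator (ε := ENNReal.ofReal η) (by simpa using hη0)
  obtain ⟨b, hb⟩ := exists_norm_cellMean_le (d := d) hr hp M
  obtain ⟨S, hS⟩ := exists_finset_mul_measure_rpow_le (measurable_gridIndex r) hA hAfin.ne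
    (b := ENNReal.ofReal b) ENNReal.ofReal_ne_top (ENNReal.ofReal_pos.2 hη0)
    (one_div_pos.2 (ENNReal.toReal_pos (zero_lt_one.trans_le h1).ne' hp))
  obtain ⟨C, hC, hCstep⟩ := exists_isCompact_stepFunctions (p := p) hr b S
  refine ⟨C, hC, fun f hf => ?_⟩
  obtain ⟨g, hgC, hg⟩ := hCstep (cellMean r f) (hb f (hM f hf))
  refine ⟨g, hgC, ?_⟩
  have hsum : (2 ^ d + 2) * ENNReal.ofReal η = ENNReal.ofReal ε := by
    rw [show (2 : ℝ≥0∞) ^ d + 2 = ENNReal.ofReal (2 ^ d + 2) by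
      rw [ENNReal.ofReal_add (by positivity) (by positivity), ENNReal.ofReal_pow (by positivity)]
      simp, ← ENNReal.ofReal_mul (by positivity), hη, mul_div_cancel₀ _ (by positivity)]
  rw [← edist_le_ofReal hε.le, Lp.edist_def, eLpNorm_congr_ae (Filter.EventuallyEq.rfl.sub hg),
    ← hsum]
  exact eLpNorm_sub_indicator_cellMean_le hr h1 hp (Lp.stronglyMeasurable f) (Lp.memLp f)
    (fun z hz => hδK f hf z (by simpa using hrδ hz)) hA (hAK ⟨f, hf⟩) (hb f (hM f hf)) hS

end KolmogorovRiesz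

section SobolevSpace

variable {d : ℕ} {Ω : Opens (E d)} {k : ℕ} {p : ℝ≥0∞} [Fact (1 ≤ p)]

theorem zero_mem_multiIndicesLE (d k : ℕ) : (0 : Fin d → ℕ) ∈ multiIndicesLE d k :=
  mem_multiIndicesLE.2 (by simp)

theorem Sobolev.weakDeriv_sub {α : Fin d → ℕ} (hα : α ∈ multiIndicesLE d k)
    (f g : Sobolev Ω k p) : (f - g).weakDeriv α = f.weakDeriv α - g.weakDeriv α := by
  rw [eq_sub_iff_add_eq, ← Sobolev.weakDeriv_add hα, sub_add_cancel]

theorem Sobolev.dist_weakDeriv {α : Fin d → ℕ} (hα : α ∈ multiIndicesLE d k)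
    (f g : Sobolev Ω k p) : dist (f.weakDeriv α) (g.weakDeriv α) = ‖(f - g).weakDeriv α‖ := by
  rw [dist_eq_norm, Sobolev.weakDeriv_sub hα]

theorem Sobolev.norm_weakDeriv_le_norm {α : Fin d → ℕ} (hα : α ∈ multiIndicesLE d k)
    (f : Sobolev Ω k p) : ‖f.weakDeriv α‖ ≤ ‖f‖ :=
  Finset.single_le_sum (f := fun α => ‖f.weakDeriv α‖) (fun _ _ => norm_nonneg _) hα

theorem Sobolev.continuous_weakDeriv {α : Fin d → ℕ} (hα : α ∈ multiIndicesLE d k) :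
    Continuous fun f : Sobolev Ω k p => f.weakDeriv α := by
  refine (LipschitzWith.mk_one fun f g => ?_).continuous
  rw [Sobolev.dist_weakDeriv hα, dist_eq_norm]
  exact Sobolev.norm_weakDeriv_le_norm hα _

theorem continuous_integral_mul {ψ : E d → ℝ} (hψ : Continuous ψ) (hc : HasCompactSupport ψ) :
    Continuous fun u : LpOn Ω p => ∫ x in (Ω : Set (E d)), u x * ψ x := by
  let q := ENNReal.conjExponent p
  have : Fact (1 ≤ q) := ⟨ENNReal.HolderConjugate.one_le q p⟩
  have hψq : MemLp ψ q (volume.restrict (Ω : Set (E d))) := hψ.memLp_of_hasCompactSupport hc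
  have pairing_continuous : Continuous fun u : LpOn Ω p => (ContinuousLinearMap.lpPairing
      (volume.restrict (Ω : Set (E d))) p q (ContinuousLinearMap.mul ℝ ℝ)) u (hψq.toLp ψ) := by
    fun_prop
  refine pairing_continuous.congr fun u => ?_
  rw [ContinuousLinearMap.lpPairing_eq_integral]
  refine integral_congr_ae ?_
  filter_upwards [hψq.coeFn_toLp] with x hx
  rw [hx, ContinuousLinearMap.mul_apply']

theorem isClosed_hasWeakDeriv (Ω : Opens (E d)) (p : ℝ≥0∞) [Fact (1 ≤ p)] (α : Fin d → ℕ) :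
    IsClosed {w : LpOn Ω p × LpOn Ω p | HasWeakDeriv Ω α w.1 w.2} := by
  simp only [HasWeakDeriv, Set.ofPred_forall]
  refine isClosed_iInter fun φ => isClosed_iInter fun hφ => isClosed_eq ?_ ?_
  · have hφα := hφ.multiDeriv α
    exact (continuous_integral_mul hφα.smooth.continuous hφα.compact).comp continuous_fst
  · exact continuous_const.mul
      ((continuous_integral_mul hφ.smooth.continuous hφ.compact).comp continuous_snd)

/-- The family of the weak derivatives of order at most `k`; it embeds `W^{k,p}(Ω)` as a closed
subset of a finite power of `L^p(Ω)`. -/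
def Sobolev.jet (f : Sobolev Ω k p) : multiIndicesLE d k → LpOn Ω p := fun α => f.weakDeriv α

theorem Sobolev.range_jet :
    Set.range (Sobolev.jet : Sobolev Ω k p → _) = {v | ∀ α : multiIndicesLE d k,
      HasWeakDeriv Ω α (v ⟨0, zero_mem_multiIndicesLE d k⟩) (v α)} := by
  ext v
  constructor
  · rintro ⟨f, rfl⟩ α
    change HasWeakDeriv Ω α (f.weakDeriv 0) (f.weakDeriv α)
    rw [f.weakDeriv_zero_index]
    exact f.hasWeakDeriv α.2
  · intro h
    let f : Sobolev Ω k p :=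
      ⟨v ⟨0, zero_mem_multiIndicesLE d k⟩, fun α hα => ⟨v ⟨α, hα⟩, h ⟨α, hα⟩⟩⟩
    exact ⟨f, funext fun α => (f.hasWeakDeriv α.2).unique (h α)⟩

theorem Sobolev.isClosed_range_jet :
    IsClosed (Set.range (Sobolev.jet : Sobolev Ω k p → multiIndicesLE d k → LpOn Ω p)) := by
  simp only [Sobolev.range_jet, Set.ofPred_forall]
  refine isClosed_iInter fun α => ?_
  have hcont : Continuous fun v : multiIndicesLE d k → LpOn Ω p =>
      (v ⟨0, zero_mem_multiIndicesLE d k⟩, v α) := by fun_prop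
  exact (isClosed_hasWeakDeriv Ω p α).preimage hcont

theorem Sobolev.lipschitzWith_jet :
    LipschitzWith 1 (Sobolev.jet : Sobolev Ω k p → multiIndicesLE d k → LpOn Ω p) := by
  refine LipschitzWith.mk_one fun f g => (dist_pi_le_iff dist_nonneg).2 fun α => ?_
  rw [Sobolev.jet, Sobolev.jet, Sobolev.dist_weakDeriv α.2, dist_eq_norm]
  exact Sobolev.norm_weakDeriv_le_norm α.2 _

theorem Sobolev.antilipschitzWith_jet : AntilipschitzWith (multiIndicesLE d k).card
    (Sobolev.jet : Sobolev Ω k p → multiIndicesLE d k → LpOn Ω p) := by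
  refine AntilipschitzWith.of_le_mul_dist fun f g => ?_
  have norm_weakDeriv_le : ∀ α ∈ multiIndicesLE d k, ‖(f - g).weakDeriv α‖ ≤ dist f.jet g.jet := by
    intro α hα
    rw [← Sobolev.dist_weakDeriv hα]
    exact dist_le_pi_dist f.jet g.jet ⟨α, hα⟩
  simpa [dist_eq_norm, Sobolev.norm_def] using Finset.sum_le_card_nsmul _ _ _ norm_weakDeriv_le

theorem Sobolev.isClosedEmbedding_jet : Topology.IsClosedEmbedding
    (Sobolev.jet : Sobolev Ω k p → multiIndicesLE d k → LpOn Ω p) :=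
  ⟨(Sobolev.antilipschitzWith_jet.isUniformEmbedding
    Sobolev.lipschitzWith_jet.uniformContinuous).isEmbedding, Sobolev.isClosed_range_jet⟩

theorem Sobolev.isCompact_closure_of_totallyBounded {G : Set (Sobolev Ω k p)}
    (h : ∀ α ∈ multiIndicesLE d k, TotallyBounded ((Sobolev.weakDeriv α) '' G)) :
    IsCompact (closure G) := by
  have hcompact : IsCompact (Set.univ.pi fun α : multiIndicesLE d k =>
      closure ((Sobolev.weakDeriv (α : Fin d → ℕ)) '' G)) :=
    isCompact_univ_pi fun α => (h α α.2).closure.isCompact_of_isClosed isClosed_closure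
  refine (Sobolev.isClosedEmbedding_jet.isCompact_preimage hcompact).of_isClosed_subset
    isClosed_closure (closure_minimal ?_ ?_)
  · exact fun g hg α _ => subset_closure ⟨g, hg, rfl⟩
  · exact hcompact.isClosed.preimage Sobolev.isClosedEmbedding_jet.continuous

end SobolevSpace

section ZeroExtension

variable {d : ℕ} {Ω : Opens (E d)} {k : ℕ} {p : ℝ≥0∞}

theorem restrict_coe_top :
    (volume : Measure (E d)).restrict ((⊤ : Opens (E d)) : Set (E d)) = volume := by simp

theorem ae_eq_top_iff {u v : E d → ℝ} :
    u =ᵐ[volume.restrict ((⊤ : Opens (E d)) : Set (E d))] v ↔ u =ᵐ[volume] v := by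
  rw [restrict_coe_top]

theorem ext_top {u v : LpOn (⊤ : Opens (E d)) p} (h : u =ᵐ[volume] v) : u = v :=
  Lp.ext (ae_eq_top_iff.2 h)

theorem ofReal_norm_eq_eLpNorm {u : LpOn (⊤ : Opens (E d)) p} {φ : E d → ℝ}
    (hu : u =ᵐ[volume] φ) : ENNReal.ofReal ‖u‖ = eLpNorm φ p volume := by
  rw [Lp.norm_def, ENNReal.ofReal_toReal (Lp.eLpNorm_ne_top u),
    eLpNorm_congr_ae (ae_eq_top_iff.2 hu), restrict_coe_top]

theorem memLp_indicator (u : LpOn Ω p) :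
    MemLp ((Ω : Set (E d)).indicator u) p (volume.restrict ((⊤ : Opens (E d)) : Set (E d))) := by
  rw [restrict_coe_top, memLp_indicator_iff_restrict Ω.isOpen.measurableSet]
  exact Lp.memLp u

theorem indicator_ae_eq_indicator_top_iff {u v : E d → ℝ} :
    (Ω : Set (E d)).indicator u =ᵐ[volume.restrict ((⊤ : Opens (E d)) : Set (E d))]
      (Ω : Set (E d)).indicator v ↔ u =ᵐ[volume.restrict (Ω : Set (E d))] v := by
  rw [ae_eq_top_iff, ae_eq_restrict_iff_indicator_ae_eq Ω.isOpen.measurableSet]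

/-- The extension by zero of functions in `L^p(Ω)` to `ℝ^d`. -/
def extendLp [Fact (1 ≤ p)] : LpOn Ω p →ₗᵢ[ℝ] LpOn (⊤ : Opens (E d)) p where
  toFun u := (memLp_indicator u).toLp _
  map_add' u v := by
    rw [← MemLp.toLp_add, MemLp.toLp_eq_toLp_iff, ← Set.indicator_add']
    exact indicator_ae_eq_indicator_top_iff.2 (Lp.coeFn_add u v)
  map_smul' c u := by
    rw [RingHom.id_apply, ← MemLp.toLp_const_smul, MemLp.toLp_eq_toLp_iff,
      show c • (Ω : Set (E d)).indicator u = (Ω : Set (E d)).indicator (c • ⇑u) from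
        (Set.indicator_const_smul _ c u).symm]
    exact indicator_ae_eq_indicator_top_iff.2 (Lp.coeFn_smul c u)
  norm_map' u := by
    change ‖(memLp_indicator u).toLp _‖ = ‖u‖
    rw [Lp.norm_toLp, Lp.norm_def, restrict_coe_top,
      eLpNorm_indicator_eq_eLpNorm_restrict Ω.isOpen.measurableSet]

theorem IsTestFunction.mono {Ω' : Opens (E d)} {φ : E d → ℝ} (hφ : IsTestFunction Ω φ)
    (hΩ : Ω ≤ Ω') : IsTestFunction Ω' φ :=
  ⟨hφ.smooth, hφ.compact, hφ.subset.trans hΩ⟩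

theorem IsTestFunction.support_subset {φ : E d → ℝ} (hφ : IsTestFunction Ω φ) :
    Function.support φ ⊆ (Ω : Set (E d)) :=
  (subset_tsupport φ).trans hφ.subset

theorem IsTestFunction.setIntegral_mul {φ : E d → ℝ} (hφ : IsTestFunction Ω φ) (ψ : E d → ℝ) :
    ∫ x in (Ω : Set (E d)), φ x * ψ x = ∫ x, φ x * ψ x :=
  setIntegral_eq_integral_of_forall_compl_eq_zero fun x hx => by
    rw [Function.notMem_support.1 fun h => hx (hφ.support_subset h), zero_mul]

theorem IsTestFunction.hasWeakDeriv {φ : E d → ℝ} (hφ : IsTestFunction Ω φ) {u v : E d → ℝ}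
    {α : Fin d → ℕ} (hu : u =ᵐ[volume.restrict (Ω : Set (E d))] φ)
    (hv : v =ᵐ[volume.restrict (Ω : Set (E d))] SobolevCompactness.multiDeriv α φ) :
    HasWeakDeriv Ω α u v := by
  intro ψ hψ
  calc ∫ x in (Ω : Set (E d)), u x * SobolevCompactness.multiDeriv α ψ x
      = ∫ x, φ x * SobolevCompactness.multiDeriv α ψ x :=
        (integral_congr_ae (hu.mul .rfl)).trans (hφ.setIntegral_mul _)
    _ = (-1) ^ (∑ i, α i) * ∫ x, SobolevCompactness.multiDeriv α φ x * ψ x :=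
        integral_mul_multiDeriv hφ.smooth hφ.compact hψ.smooth α
    _ = (-1) ^ (∑ i, α i) * ∫ x in (Ω : Set (E d)), v x * ψ x := by
        rw [← (hφ.multiDeriv α).setIntegral_mul]
        exact congrArg _ (integral_congr_ae (hv.mul .rfl)).symm

variable [Fact (1 ≤ p)]

theorem coeFn_extendLp (u : LpOn Ω p) : extendLp u =ᵐ[volume] (Ω : Set (E d)).indicator u :=
  ae_eq_top_iff.1 (memLp_indicator u).coeFn_toLp

theorem IsTestFunction.extendLp_ae_eq {φ : E d → ℝ} (hφ : IsTestFunction Ω φ) {u : LpOn Ω p}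
    (hu : u =ᵐ[volume.restrict (Ω : Set (E d))] φ) : extendLp u =ᵐ[volume] φ := by
  refine (coeFn_extendLp u).trans ?_
  rw [← Set.indicator_eq_self.2 hφ.support_subset]
  exact (ae_eq_restrict_iff_indicator_ae_eq Ω.isOpen.measurableSet).1 hu

theorem IsTestFunction.weakDeriv_ae_eq {φ : E d → ℝ} (hφ : IsTestFunction Ω φ)
    {f : Sobolev Ω k p} (hf : f.toLp =ᵐ[volume.restrict (Ω : Set (E d))] φ) {α : Fin d → ℕ}
    (hα : α ∈ multiIndicesLE d k) :
    f.weakDeriv α =ᵐ[volume.restrict (Ω : Set (E d))] SobolevCompactness.multiDeriv α φ := by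
  have hα' := hφ.multiDeriv α
  have hmem : MemLp (SobolevCompactness.multiDeriv α φ) p (volume.restrict (Ω : Set (E d))) :=
    hα'.smooth.continuous.memLp_of_hasCompactSupport hα'.compact
  rw [(Sobolev.hasWeakDeriv hα f).unique (hφ.hasWeakDeriv hf hmem.coeFn_toLp)]
  exact hmem.coeFn_toLp

theorem IsTestFunction.extendLp_weakDeriv_ae_eq {φ : E d → ℝ} (hφ : IsTestFunction Ω φ)
    {f : Sobolev Ω k p} (hf : f.toLp =ᵐ[volume.restrict (Ω : Set (E d))] φ) {α : Fin d → ℕ}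
    (hα : α ∈ multiIndicesLE d k) :
    extendLp (f.weakDeriv α) =ᵐ[volume] SobolevCompactness.multiDeriv α φ :=
  (hφ.multiDeriv α).extendLp_ae_eq (hφ.weakDeriv_ae_eq hf hα)

theorem sobolevZero_induction {P : Sobolev Ω k p → Prop} (isClosed : IsClosed {f | P f})
    (test : ∀ (f : Sobolev Ω k p) (φ : E d → ℝ), IsTestFunction Ω φ →
      f.toLp =ᵐ[volume.restrict (Ω : Set (E d))] φ → P f)
    {f : Sobolev Ω k p} (hf : f ∈ sobolevZero Ω k p) : P f :=
  closure_minimal (t := {f | P f}) (by rintro f ⟨φ, hφ, hfφ⟩; exact test f φ hφ hfφ)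
    isClosed hf

theorem continuous_extendLp_weakDeriv {α : Fin d → ℕ} (hα : α ∈ multiIndicesLE d k) :
    Continuous fun f : Sobolev Ω k p => extendLp (f.weakDeriv α) :=
  extendLp.continuous.comp (Sobolev.continuous_weakDeriv hα)

theorem hasWeakDeriv_extendLp {f : Sobolev Ω k p} (hf : f ∈ sobolevZero Ω k p) {α : Fin d → ℕ}
    (hα : α ∈ multiIndicesLE d k) :
    HasWeakDeriv ⊤ α (extendLp f.toLp) (extendLp (f.weakDeriv α)) := by
  refine sobolevZero_induction
    (P := fun f => HasWeakDeriv ⊤ α (extendLp f.toLp) (extendLp (f.weakDeriv α))) ?_ ?_ hf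
  · simp only [← Sobolev.weakDeriv_zero_index]
    exact (isClosed_hasWeakDeriv ⊤ p α).preimage
      ((continuous_extendLp_weakDeriv (zero_mem_multiIndicesLE d k)).prodMk
        (continuous_extendLp_weakDeriv hα))
  · exact fun f φ hφ hfφ => (hφ.mono le_top).hasWeakDeriv
      (ae_eq_top_iff.2 (hφ.extendLp_ae_eq hfφ))
      (ae_eq_top_iff.2 (hφ.extendLp_weakDeriv_ae_eq hfφ hα))

theorem exists_isZeroExtension {f : Sobolev Ω k p} (hf : f ∈ sobolevZero Ω k p) :
    ∃ g : Sobolev (⊤ : Opens (E d)) k p, IsZeroExtension f g :=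
  ⟨⟨extendLp f.toLp, fun _ hα => ⟨_, hasWeakDeriv_extendLp hf hα⟩⟩, coeFn_extendLp f.toLp⟩

theorem IsZeroExtension.weakDeriv_eq {f : Sobolev Ω k p} {g : Sobolev (⊤ : Opens (E d)) k p}
    (h : IsZeroExtension f g) (hf : f ∈ sobolevZero Ω k p) {α : Fin d → ℕ}
    (hα : α ∈ multiIndicesLE d k) : g.weakDeriv α = extendLp (f.weakDeriv α) := by
  have hg : g.toLp = extendLp f.toLp := ext_top (h.trans (coeFn_extendLp f.toLp).symm)
  exact (g.hasWeakDeriv hα).unique (hg ▸ hasWeakDeriv_extendLp hf hα)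

theorem IsZeroExtension.norm_eq {f : Sobolev Ω k p} {g : Sobolev (⊤ : Opens (E d)) k p}
    (h : IsZeroExtension f g) (hf : f ∈ sobolevZero Ω k p) : ‖g‖ = ‖f‖ :=
  Finset.sum_congr rfl fun α hα => by rw [h.weakDeriv_eq hf hα, extendLp.norm_map]

end ZeroExtension

section Translation

variable {d : ℕ} {k : ℕ} {p : ℝ≥0∞} [Fact (1 ≤ p)]

/-- The translation `u ↦ u(· + h)` on `L^p(ℝ^d)`. -/
def shiftLp (h : E d) : LpOn (⊤ : Opens (E d)) p →ₗᵢ[ℝ] LpOn (⊤ : Opens (E d)) p :=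
  Lp.compMeasurePreservingₗᵢ ℝ _ (measurePreserving_shift h)

theorem coeFn_shiftLp (h : E d) (u : LpOn (⊤ : Opens (E d)) p) :
    shiftLp h u =ᵐ[volume] fun x => u (x + h) :=
  ae_eq_top_iff.1 (Lp.coeFn_compMeasurePreserving u (measurePreserving_shift h))

theorem coeFn_shiftLp_sub_of_ae_eq {u : LpOn (⊤ : Opens (E d)) p} {φ : E d → ℝ}
    (hu : u =ᵐ[volume] φ) (h : E d) :
    (shiftLp h u - u : LpOn (⊤ : Opens (E d)) p) =ᵐ[volume] fun x => φ (x + h) - φ x := by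
  have hu_shift : ∀ᵐ x, u (x + h) = φ (x + h) :=
    (measurePreserving_add_right (volume : Measure (E d)) h).quasiMeasurePreserving.ae hu
  filter_upwards [ae_eq_top_iff.1 (Lp.coeFn_sub (shiftLp h u) u), coeFn_shiftLp h u, hu, hu_shift]
    with x hsub hshift hx hxh
  rw [hsub, Pi.sub_apply, hshift, hx, hxh]

theorem tendsto_shiftLp (hp : p ≠ ⊤) (u : LpOn (⊤ : Opens (E d)) p) :
    Filter.Tendsto (fun h => shiftLp h u) (nhds 0) (nhds u) := by
  let shift (h : E d) : C(E d, E d) := ⟨fun x => x + h, by fun_prop⟩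
  have shift_continuous : Continuous shift := ContinuousMap.continuous_of_continuous_uncurry _
    (show Continuous fun q : E d × E d => q.2 + q.1 by fun_prop)
  have shift_zero : shiftLp 0 u = u := by
    refine ext_top ((coeFn_shiftLp 0 u).trans (.of_eq ?_))
    simp only [add_zero]
  conv_rhs => rw [← shift_zero]
  exact ((continuous_const (y := u)).compMeasurePreservingLp shift_continuous
    measurePreserving_shift hp).tendsto 0

theorem weakDeriv_translate (h : E d) (g : Sobolev (⊤ : Opens (E d)) k p) {α : Fin d → ℕ}
    (hα : α ∈ multiIndicesLE d k) :
    (translate h g).weakDeriv α = shiftLp h (g.weakDeriv α) :=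
  (Sobolev.hasWeakDeriv hα (translate h g)).unique ((Sobolev.hasWeakDeriv hα g).shift h)

theorem norm_translate_sub (h : E d) (g : Sobolev (⊤ : Opens (E d)) k p) :
    ‖translate h g - g‖ =
      ∑ α ∈ multiIndicesLE d k, ‖shiftLp h (g.weakDeriv α) - g.weakDeriv α‖ :=
  Finset.sum_congr rfl fun α hα => by rw [Sobolev.weakDeriv_sub hα, weakDeriv_translate h g hα]

theorem norm_translate_sub_translate (h : E d) (f g : Sobolev (⊤ : Opens (E d)) k p) :
    ‖translate h f - translate h g‖ = ‖f - g‖ :=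
  Finset.sum_congr rfl fun α hα => by
    rw [Sobolev.weakDeriv_sub hα, Sobolev.weakDeriv_sub hα, weakDeriv_translate h f hα,
      weakDeriv_translate h g hα, ← map_sub, LinearIsometry.norm_map]

theorem tendsto_norm_translate_sub (hp : p ≠ ⊤) (g : Sobolev (⊤ : Opens (E d)) k p) :
    Filter.Tendsto (fun h => ‖translate h g - g‖) (nhds 0) (nhds 0) := by
  simp only [norm_translate_sub]
  have hsum : Filter.Tendsto (fun h => ∑ α ∈ multiIndicesLE d k,
      ‖shiftLp h (g.weakDeriv α) - g.weakDeriv α‖) (nhds 0)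
      (nhds (∑ α ∈ multiIndicesLE d k, ‖g.weakDeriv α - g.weakDeriv α‖)) :=
    tendsto_finsetSum _ fun α _ => ((tendsto_shiftLp hp (g.weakDeriv α)).sub_const _).norm
  simpa using hsum

theorem norm_translate_sub_le (h : E d) (f g : Sobolev (⊤ : Opens (E d)) k p) :
    ‖translate h f - f‖ ≤ ‖translate h g - g‖ + 2 * ‖f - g‖ := by
  calc ‖translate h f - f‖
      = ‖(translate h f - translate h g) + (translate h g - g) - (f - g)‖ := by abel_nf
    _ ≤ ‖translate h f - translate h g‖ + ‖translate h g - g‖ + ‖f - g‖ :=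
        (norm_sub_le _ _).trans (add_le_add_left (norm_add_le _ _) _)
    _ = ‖translate h g - g‖ + 2 * ‖f - g‖ := by rw [norm_translate_sub_translate]; ring

theorem SobolevPrecompact.translationEquicontinuous (hp : p ≠ ⊤)
    {G : Set (Sobolev (⊤ : Opens (E d)) k p)} (hG : SobolevPrecompact G) :
    TranslationEquicontinuous G := by
  have exists_modulus (ε : ℝ) (hε : 0 < ε) :
      ∃ δ > 0, ∀ g ∈ G, ∀ h : E d, ‖h‖ < δ → ‖translate h g - g‖ < ε := by
    obtain ⟨t, ht, hGt⟩ := Metric.totallyBounded_iff.1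
      (hG.totallyBounded.subset subset_closure) (ε / 3) (by positivity)
    have eventually_small : ∀ᶠ h in nhds (0 : E d), ∀ y ∈ t, ‖translate h y - y‖ < ε / 3 :=
      (Filter.eventually_all_finite ht).2 fun y _ =>
        (tendsto_norm_translate_sub hp y).eventually_lt_const (by positivity)
    obtain ⟨δ, hδ, hball⟩ := Metric.eventually_nhds_iff.1 eventually_small
    refine ⟨δ, hδ, fun g hg h hh => ?_⟩
    obtain ⟨y, hy, hgy⟩ := Set.mem_iUnion₂.1 (hGt hg)
    rw [Metric.mem_ball, dist_eq_norm] at hgy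
    linarith [norm_translate_sub_le h g y, hball (y := h) (by simpa using hh) y hy]
  choose! δ hδ h using exists_modulus
  exact ⟨δ, hδ, fun g hg ε hε => h ε hε g hg⟩

theorem SobolevPrecompact.sobolevBounded {G : Set (Sobolev (⊤ : Opens (E d)) k p)}
    (hG : SobolevPrecompact G) : SobolevBounded G :=
  (hG.isBounded.subset subset_closure).exists_pos_norm_le

end Translation

section Tightness

theorem unifTight_of_totallyBounded {X V : Type*} [MeasurableSpace X] {μ : Measure X}
    [NormedAddCommGroup V] {p : ℝ≥0∞} [Fact (1 ≤ p)] (hp : p ≠ ⊤) {K : Set (Lp V p μ)}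
    (hK : TotallyBounded K) : UnifTight (fun f : K => ⇑(f : Lp V p μ)) p μ := by
  refine (unifTight_iff_real _ _ _).2 fun ε hε => ?_
  obtain ⟨t, ht, hKt⟩ := Metric.totallyBounded_iff.1 hK (ε / 2) (by positivity)
  have : Finite t := ht
  have net_unifTight : UnifTight (fun y : t => ⇑(y : Lp V p μ)) p μ :=
    unifTight_finite hp fun y => Lp.memLp (y : Lp V p μ)
  obtain ⟨s, hs, hμs, hts⟩ := net_unifTight.exists_measurableSet_indicator
    (ε := ENNReal.ofReal (ε / 2)) (ENNReal.ofReal_pos.2 (by positivity)).ne'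
  refine ⟨s, hμs.ne, fun f => ?_⟩
  obtain ⟨y, hy, hfy⟩ := Set.mem_iUnion₂.1 (hKt f.2)
  have indicator_ae_eq : sᶜ.indicator (f : Lp V p μ) =ᵐ[μ]
      sᶜ.indicator (f - y : Lp V p μ) + sᶜ.indicator y := by
    rw [← Set.indicator_add']
    refine Filter.EventuallyEq.indicator ?_
    filter_upwards [Lp.coeFn_sub (f : Lp V p μ) y] with x hx
    rw [Pi.add_apply, hx, Pi.sub_apply, sub_add_cancel]
  have norm_sub_le : eLpNorm (f - y : Lp V p μ) p μ ≤ ENNReal.ofReal (ε / 2) := by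
    rw [← Lp.enorm_def, ← ofReal_norm, ← dist_eq_norm]
    exact ENNReal.ofReal_le_ofReal (Metric.mem_ball.1 hfy).le
  calc eLpNorm (sᶜ.indicator (f : Lp V p μ)) p μ
      = eLpNorm (sᶜ.indicator (f - y : Lp V p μ) + sᶜ.indicator y) p μ :=
        eLpNorm_congr_ae indicator_ae_eq
    _ ≤ eLpNorm (sᶜ.indicator (f - y : Lp V p μ)) p μ + eLpNorm (sᶜ.indicator y) p μ :=
        eLpNorm_add_le ((Lp.aestronglyMeasurable _).indicator hs.compl)
          ((Lp.aestronglyMeasurable _).indicator hs.compl) Fact.out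
    _ ≤ ENNReal.ofReal (ε / 2) + ENNReal.ofReal (ε / 2) :=
        add_le_add ((eLpNorm_indicator_le _).trans norm_sub_le) (hts ⟨y, hy⟩)
    _ = ENNReal.ofReal ε := by
        rw [← ENNReal.ofReal_add (by positivity) (by positivity), add_halves]

theorem eLpNorm_indicator_le_ofReal_iff {X : Type*} [MeasurableSpace X] {μ : Measure X}
    {u : X → ℝ} {p : ℝ≥0∞} (hu : MemLp u p μ) (hp0 : p ≠ 0) (hp : p ≠ ⊤) {t : Set X}
    (ht : MeasurableSet t) {c : ℝ} (hc : 0 ≤ c) :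
    eLpNorm (t.indicator u) p μ ≤ ENNReal.ofReal c ↔
      ∫ x in t, |u x| ^ p.toReal ∂μ ≤ c ^ p.toReal := by
  rw [eLpNorm_indicator_eq_eLpNorm_restrict ht,
    MemLp.eLpNorm_eq_integral_rpow_norm hp0 hp (hu.mono_measure Measure.restrict_le_self),
    ENNReal.ofReal_le_ofReal_iff hc,
    Real.rpow_inv_le_iff_of_pos (by positivity) hc (ENNReal.toReal_pos hp0 hp)]
  rfl

theorem memLp_top {d : ℕ} {p : ℝ≥0∞} (u : LpOn (⊤ : Opens (E d)) p) : MemLp u p volume := by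
  simpa using Lp.memLp u

variable {d k : ℕ} {p : ℝ≥0∞} [Fact (1 ≤ p)] {G : Set (Sobolev (⊤ : Opens (E d)) k p)}

theorem integrable_abs_rpow (hp : p ≠ ⊤) (u : LpOn (⊤ : Opens (E d)) p) :
    Integrable (fun x => |u x| ^ p.toReal) volume :=
  (memLp_top u).integrable_norm_rpow (zero_lt_one.trans_le Fact.out).ne' hp

theorem SmallAtInfinity.unifTight (hp : p ≠ ⊤) (hG : SmallAtInfinity G) {α : Fin d → ℕ}
    (hα : α ∈ multiIndicesLE d k) :
    UnifTight (fun u : Sobolev.weakDeriv α '' G => ⇑(u : LpOn (⊤ : Opens (E d)) p)) p volume := by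
  have hp0 : p ≠ 0 := (zero_lt_one.trans_le Fact.out).ne'
  obtain ⟨A, hA, hGA⟩ := hG
  refine (unifTight_iff_real _ _ _).2 fun ε hε =>
    ⟨toMeasurable volume (A ε), by rw [measure_toMeasurable]; exact (hA ε hε).2.ne, ?_⟩
  rintro ⟨_, g, hg, rfl⟩
  refine (eLpNorm_indicator_le_ofReal_iff (memLp_top _) hp0 hp
    (measurableSet_toMeasurable _ _).compl hε.le).2 ?_
  have sum_lt := hGA g hg ε hε
  rw [one_div, Real.rpow_inv_lt_iff_of_pos (Finset.sum_nonneg fun _ _ => by positivity) hε.le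
    (ENNReal.toReal_pos hp0 hp)] at sum_lt
  calc ∫ x in (toMeasurable volume (A ε))ᶜ, |g.weakDeriv α x| ^ p.toReal
      ≤ ∫ x in (A ε)ᶜ, |g.weakDeriv α x| ^ p.toReal :=
        setIntegral_mono_set (integrable_abs_rpow hp _).integrableOn
          (.of_forall fun _ => by positivity)
          (Set.compl_subset_compl.2 (subset_toMeasurable _ _)).eventuallyLE
    _ ≤ ∑ β ∈ multiIndicesLE d k, ∫ x in (A ε)ᶜ, |g.weakDeriv β x| ^ p.toReal :=
        Finset.single_le_sum (f := fun β => ∫ x in (A ε)ᶜ, |g.weakDeriv β x| ^ p.toReal)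
          (fun _ _ => by positivity) hα
    _ ≤ ε ^ p.toReal := sum_lt.le

theorem smallAtInfinity_of_unifTight (hp : p ≠ ⊤) (hG : ∀ α ∈ multiIndicesLE d k, UnifTight
      (fun u : Sobolev.weakDeriv α '' G => ⇑(u : LpOn (⊤ : Opens (E d)) p)) p volume) :
    SmallAtInfinity G := by
  have hp0 : p ≠ 0 := (zero_lt_one.trans_le Fact.out).ne'
  have hp_pos : 0 < p.toReal := ENNReal.toReal_pos hp0 hp
  set N := (multiIndicesLE d k).card
  have exists_set (ε : ℝ) (hε : 0 < ε) (α : Fin d → ℕ) (hα : α ∈ multiIndicesLE d k) :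
      ∃ s : Set (E d), MeasurableSet s ∧ volume s < ⊤ ∧ ∀ g ∈ G,
        ∫ x in sᶜ, |g.weakDeriv α x| ^ p.toReal ≤ ε ^ p.toReal / (N + 1) := by
    set c := (ε ^ p.toReal / (N + 1)) ^ p.toReal⁻¹
    have hc : 0 < c := by positivity
    have hcp : c ^ p.toReal = ε ^ p.toReal / (N + 1) :=
      Real.rpow_inv_rpow (by positivity) hp_pos.ne'
    obtain ⟨s, hs, hs_fin, hGs⟩ :=
      (hG α hα).exists_measurableSet_indicator (ENNReal.ofReal_pos.2 hc).ne'
    refine ⟨s, hs, hs_fin, fun g hg => ?_⟩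
    rw [← hcp]
    exact (eLpNorm_indicator_le_ofReal_iff (memLp_top _) hp0 hp hs.compl hc.le).1
      (hGs ⟨_, g, hg, rfl⟩)
  choose! s hs hs_fin hGs using exists_set
  refine ⟨fun ε => ⋃ α ∈ multiIndicesLE d k, s ε α, fun ε hε => ⟨?_, ?_⟩, fun g hg ε hε => ?_⟩
  · exact (Finset.measurableSet_biUnion _ (hs ε hε)).nullMeasurableSet
  · exact measure_biUnion_lt_top (Finset.finite_toSet _) (hs_fin ε hε)
  · rw [one_div, Real.rpow_inv_lt_iff_of_pos (Finset.sum_nonneg fun _ _ => by positivity) hε.le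
      hp_pos]
    calc ∑ α ∈ multiIndicesLE d k,
          ∫ x in (⋃ β ∈ multiIndicesLE d k, s ε β)ᶜ, |g.weakDeriv α x| ^ p.toReal
        ≤ ∑ α ∈ multiIndicesLE d k, ∫ x in (s ε α)ᶜ, |g.weakDeriv α x| ^ p.toReal :=
          Finset.sum_le_sum fun α hα => setIntegral_mono_set
            (integrable_abs_rpow hp _).integrableOn (.of_forall fun _ => by positivity)
            (Set.compl_subset_compl.2 (Set.subset_biUnion_of_mem hα)).eventuallyLE
      _ ≤ N * (ε ^ p.toReal / (N + 1)) := by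
          rw [← nsmul_eq_mul]
          exact Finset.sum_le_card_nsmul _ _ _ fun α hα => hGs ε hε α hα g hg
      _ < ε ^ p.toReal := by
          have hε_pow : 0 < ε ^ p.toReal := by positivity
          rw [mul_div_assoc', div_lt_iff₀ (by positivity)]
          linarith

end Tightness

section Compactness

variable {d k : ℕ} {p : ℝ≥0∞} [Fact (1 ≤ p)] {G : Set (Sobolev (⊤ : Opens (E d)) k p)}

theorem SobolevPrecompact.smallAtInfinity (hp : p ≠ ⊤) (hG : SobolevPrecompact G) :
    SmallAtInfinity G := by
  refine smallAtInfinity_of_unifTight hp fun α hα => ?_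
  have htb : TotallyBounded (Sobolev.weakDeriv α '' G) :=
    (hG.image (Sobolev.continuous_weakDeriv hα)).totallyBounded.subset
      (Set.image_mono subset_closure)
  exact (congrArg (UnifTight _ p) restrict_coe_top).mp (unifTight_of_totallyBounded hp htb)

theorem sobolevPrecompact_of_equicontinuous_of_small (hp : p ≠ ⊤) (hB : SobolevBounded G)
    (hT : TranslationEquicontinuous G) (hS : SmallAtInfinity G) : SobolevPrecompact G := by
  obtain ⟨M, -, hM⟩ := hB
  obtain ⟨δ, hδ, hδG⟩ := hT
  refine Sobolev.isCompact_closure_of_totallyBounded fun α hα =>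
    totallyBounded_of_translation_equicontinuous (M := M) hp restrict_coe_top ?_ ?_
      (hS.unifTight hp hα)
  · rintro _ ⟨g, hg, rfl⟩
    exact (g.norm_weakDeriv_le_norm hα).trans (hM g hg)
  · refine fun ε hε => ⟨δ ε, hδ ε hε, ?_⟩
    rintro _ ⟨g, hg, rfl⟩ h hh
    rw [← ofReal_norm_eq_eLpNorm (coeFn_shiftLp_sub_of_ae_eq .rfl h)]
    refine ENNReal.ofReal_le_ofReal (le_trans ?_ (hδG g hg ε hε h hh).le)
    rw [norm_translate_sub]
    exact Finset.single_le_sum (f := fun α => ‖shiftLp h (g.weakDeriv α) - g.weakDeriv α‖)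
      (fun _ _ => norm_nonneg _) hα

theorem sobolevPrecompact_iff (hp : p ≠ ⊤) : SobolevPrecompact G ↔
    SobolevBounded G ∧ TranslationEquicontinuous G ∧ SmallAtInfinity G :=
  ⟨fun h => ⟨h.sobolevBounded, h.translationEquicontinuous hp, h.smallAtInfinity hp⟩,
    fun h => sobolevPrecompact_of_equicontinuous_of_small hp h.1 h.2.1 h.2.2⟩

end Compactness

section TopOrder

variable {d k : ℕ}

/-- The multi-index of order `k` obtained from `α` by raising its `i`-th entry; the truncated
subtraction makes this meaningful for `|α| ≤ k` only. -/
def raiseIndex (k : ℕ) (i : Fin d) (α : Fin d → ℕ) : Fin d → ℕ :=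
  α + (k - ∑ j, α j) • Pi.single i 1

theorem raiseIndex_mem (i : Fin d) {α : Fin d → ℕ} (hα : α ∈ multiIndicesLE d k) :
    raiseIndex k i α ∈ multiIndicesEq d k := by
  have sum_raiseIndex : ∑ j, raiseIndex k i α j = ∑ j, α j + (k - ∑ j, α j) := by
    simp [raiseIndex, Finset.sum_add_distrib, ← Finset.mul_sum]
  rw [mem_multiIndicesEq, sum_raiseIndex, Nat.add_sub_cancel' (mem_multiIndicesLE.1 hα)]

theorem multiIndicesEq_subset : multiIndicesEq d k ⊆ multiIndicesLE d k :=
  Finset.filter_subset _ _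

theorem sum_multiIndicesLE_le (i : Fin d) {a : (Fin d → ℕ) → ℝ} (ha : ∀ α, 0 ≤ a α) {C : ℝ}
    (hC : 0 ≤ C) (h : ∀ α ∈ multiIndicesLE d k, a α ≤ C * a (raiseIndex k i α)) :
    ∑ α ∈ multiIndicesLE d k, a α ≤
      (multiIndicesLE d k).card * C * ∑ α ∈ multiIndicesEq d k, a α := by
  rw [mul_assoc, ← nsmul_eq_mul]
  refine Finset.sum_le_card_nsmul _ _ _ fun α hα => (h α hα).trans ?_
  gcongr
  exact Finset.single_le_sum (fun β _ => ha β) (raiseIndex_mem i hα)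

variable {Ω : Opens (E d)} {p : ℝ≥0∞} [Fact (1 ≤ p)] {i : Fin d} {R : ℝ}

theorem slab_mono {R' : ℝ} (h : R ≤ R') : slab i R ≤ slab i R' :=
  fun _ hx => lt_of_lt_of_le (mem_slab.1 hx) h

theorem eLpNorm_multiDeriv_le_raiseIndex (hp : p ≠ ⊤) (hR : 1 ≤ R) {u : E d → ℝ}
    (hu : IsTestFunction (slab i R) u) (α : Fin d → ℕ) :
    eLpNorm (multiDeriv α u) p volume ≤
      ENNReal.ofReal ((2 * R) ^ k) * eLpNorm (multiDeriv (raiseIndex k i α) u) p volume := by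
  refine (eLpNorm_multiDeriv_le Fact.out hp (by linarith) hu α (k - ∑ j, α j)).trans ?_
  rw [← ENNReal.ofReal_pow (by linarith)]
  gcongr
  · linarith
  · exact Nat.sub_le _ _
  · rfl

theorem norm_weakDeriv_le_raiseIndex (hp : p ≠ ⊤) (hR : 1 ≤ R) (hΩ : Ω ≤ slab i R)
    {f : Sobolev Ω k p} (hf : f ∈ sobolevZero Ω k p) {α : Fin d → ℕ}
    (hα : α ∈ multiIndicesLE d k) :
    ‖f.weakDeriv α‖ ≤ (2 * R) ^ k * ‖f.weakDeriv (raiseIndex k i α)‖ := by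
  have hβ := multiIndicesEq_subset (raiseIndex_mem i hα)
  refine sobolevZero_induction (P := fun f => ‖f.weakDeriv α‖ ≤
    (2 * R) ^ k * ‖f.weakDeriv (raiseIndex k i α)‖) ?_ ?_ hf
  · exact isClosed_le (Sobolev.continuous_weakDeriv hα).norm
      (continuous_const.mul (Sobolev.continuous_weakDeriv hβ).norm)
  · intro f φ hφ hfφ
    rw [← extendLp.norm_map, ← extendLp.norm_map (f.weakDeriv (raiseIndex k i α)),
      ← ENNReal.ofReal_le_ofReal_iff (by positivity), ENNReal.ofReal_mul (by positivity),
      ofReal_norm_eq_eLpNorm (hφ.extendLp_weakDeriv_ae_eq hfφ hα),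
      ofReal_norm_eq_eLpNorm (hφ.extendLp_weakDeriv_ae_eq hfφ hβ)]
    exact eLpNorm_multiDeriv_le_raiseIndex hp hR (hφ.mono hΩ) α

theorem norm_le_sum_norm_weakDeriv (hp : p ≠ ⊤) (hR : 1 ≤ R) (hΩ : Ω ≤ slab i R)
    {f : Sobolev Ω k p} (hf : f ∈ sobolevZero Ω k p) :
    ‖f‖ ≤ (multiIndicesLE d k).card * (2 * R) ^ k *
      ∑ α ∈ multiIndicesEq d k, ‖f.weakDeriv α‖ :=
  sum_multiIndicesLE_le i (fun _ => norm_nonneg _) (by positivity)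
    fun _ hα => norm_weakDeriv_le_raiseIndex hp hR hΩ hf hα

theorem IsTestFunction.shift_sub {φ : E d → ℝ} (hφ : IsTestFunction Ω φ) (hΩ : Ω ≤ slab i R)
    {h : E d} (hh : ‖h‖ < 1) :
    IsTestFunction (slab i (R + 1)) ((fun x => φ (x + h)) - φ) where
  smooth := (hφ.smooth.comp (contDiff_id.add contDiff_const)).sub hφ.smooth
  compact := (hφ.compact.comp_homeomorph (Homeomorph.addRight h)).sub hφ.compact
  subset := by
    refine (tsupport_sub _ _).trans (Set.union_subset (fun x hx => ?_) ?_)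
    · have shift_mem : x + h ∈ tsupport φ :=
        tsupport_comp_subset_preimage φ (Homeomorph.addRight h).continuous hx
      have abs_lt : |x i + h i| < R := mem_slab.1 (hΩ (hφ.subset shift_mem))
      have abs_le : |h i| ≤ ‖h‖ := PiLp.norm_apply_le h i
      have abs_sub : |x i| ≤ |x i + h i| + |h i| := by simpa using abs_sub (x i + h i) (h i)
      exact mem_slab.2 (by linarith)
    · exact (hφ.mono (hΩ.trans (slab_mono (by linarith)))).subset

theorem IsTestFunction.ofReal_norm_shiftLp_sub {φ : E d → ℝ} (hφ : IsTestFunction Ω φ)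
    {f : Sobolev Ω k p} (hf : f.toLp =ᵐ[volume.restrict (Ω : Set (E d))] φ) (h : E d)
    {α : Fin d → ℕ} (hα : α ∈ multiIndicesLE d k) :
    ENNReal.ofReal ‖shiftLp h (extendLp (f.weakDeriv α)) - extendLp (f.weakDeriv α)‖ =
      eLpNorm (SobolevCompactness.multiDeriv α ((fun x => φ (x + h)) - φ)) p volume := by
  have shift_smooth : ContDiff ℝ ∞ fun x => φ (x + h) :=
    hφ.smooth.comp (contDiff_id.add contDiff_const)
  rw [ofReal_norm_eq_eLpNorm (coeFn_shiftLp_sub_of_ae_eq (hφ.extendLp_weakDeriv_ae_eq hf hα) h),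
    multiDeriv_sub shift_smooth hφ.smooth, multiDeriv_shift]
  rfl

theorem norm_shiftLp_sub_le_raiseIndex (hp : p ≠ ⊤) (hR : 0 ≤ R) (hΩ : Ω ≤ slab i R)
    {f : Sobolev Ω k p} (hf : f ∈ sobolevZero Ω k p) {h : E d} (hh : ‖h‖ < 1) {α : Fin d → ℕ}
    (hα : α ∈ multiIndicesLE d k) :
    ‖shiftLp h (extendLp (f.weakDeriv α)) - extendLp (f.weakDeriv α)‖ ≤
      (2 * (R + 1)) ^ k * ‖shiftLp h (extendLp (f.weakDeriv (raiseIndex k i α))) -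
        extendLp (f.weakDeriv (raiseIndex k i α))‖ := by
  have hβ := multiIndicesEq_subset (raiseIndex_mem i hα)
  have hcont : ∀ β ∈ multiIndicesLE d k, Continuous fun f : Sobolev Ω k p =>
      ‖shiftLp h (extendLp (f.weakDeriv β)) - extendLp (f.weakDeriv β)‖ := fun β hβ =>
    (((shiftLp h).continuous.comp (continuous_extendLp_weakDeriv hβ)).sub
      (continuous_extendLp_weakDeriv hβ)).norm
  refine sobolevZero_induction (P := fun f =>
    ‖shiftLp h (extendLp (f.weakDeriv α)) - extendLp (f.weakDeriv α)‖ ≤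
      (2 * (R + 1)) ^ k * ‖shiftLp h (extendLp (f.weakDeriv (raiseIndex k i α))) -
        extendLp (f.weakDeriv (raiseIndex k i α))‖) ?_ ?_ hf
  · exact isClosed_le (hcont α hα) (continuous_const.mul (hcont _ hβ))
  · intro f φ hφ hfφ
    rw [← ENNReal.ofReal_le_ofReal_iff (by positivity), ENNReal.ofReal_mul (by positivity),
      hφ.ofReal_norm_shiftLp_sub hfφ h hα, hφ.ofReal_norm_shiftLp_sub hfφ h hβ]
    exact eLpNorm_multiDeriv_le_raiseIndex hp (by linarith) (hφ.shift_sub hΩ hh) α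

theorem IsZeroExtension.norm_translate_sub {f : Sobolev Ω k p}
    {g : Sobolev (⊤ : Opens (E d)) k p} (hfg : IsZeroExtension f g) (hf : f ∈ sobolevZero Ω k p)
    (h : E d) : ‖translate h g - g‖ = ∑ α ∈ multiIndicesLE d k,
      ‖shiftLp h (extendLp (f.weakDeriv α)) - extendLp (f.weakDeriv α)‖ := by
  rw [SobolevCompactness.norm_translate_sub]
  exact Finset.sum_congr rfl fun α hα => by rw [hfg.weakDeriv_eq hf hα]

theorem IsZeroExtension.norm_translate_sub_le (hp : p ≠ ⊤) (hR : 0 ≤ R) (hΩ : Ω ≤ slab i R)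
    {f : Sobolev Ω k p} {g : Sobolev (⊤ : Opens (E d)) k p} (hfg : IsZeroExtension f g)
    (hf : f ∈ sobolevZero Ω k p) {h : E d} (hh : ‖h‖ < 1) :
    ‖translate h g - g‖ ≤ (multiIndicesLE d k).card * (2 * (R + 1)) ^ k *
      ∑ α ∈ multiIndicesEq d k,
        ‖shiftLp h (extendLp (f.weakDeriv α)) - extendLp (f.weakDeriv α)‖ := by
  rw [hfg.norm_translate_sub hf]
  exact sum_multiIndicesLE_le i (fun _ => norm_nonneg _) (by positivity)
    fun _ hα => norm_shiftLp_sub_le_raiseIndex hp hR hΩ hf hh hα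

theorem sum_eLpNorm_indicator_shift_sub_lt_iff (f : Sobolev Ω k p) (h : E d) {ε : ℝ}
    (hε : 0 < ε) :
    ∑ α ∈ multiIndicesEq d k,
        eLpNorm (fun x => (Ω : Set (E d)).indicator (f.weakDeriv α) (x + h) -
          (Ω : Set (E d)).indicator (f.weakDeriv α) x) p volume < ENNReal.ofReal ε ↔
      ∑ α ∈ multiIndicesEq d k,
        ‖shiftLp h (extendLp (f.weakDeriv α)) - extendLp (f.weakDeriv α)‖ < ε := by
  simp only [← ofReal_norm_eq_eLpNorm (coeFn_shiftLp_sub_of_ae_eq (coeFn_extendLp _) h)]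
  rw [← ENNReal.ofReal_sum_of_nonneg fun _ _ => norm_nonneg _, ENNReal.ofReal_lt_ofReal_iff hε]

end TopOrder

section Criterion

variable {d k : ℕ} {Ω : Opens (E d)} {p : ℝ≥0∞} [Fact (1 ≤ p)] {F : Set (Sobolev Ω k p)}

theorem sobolevBounded_zeroExtension_iff (hF : F ⊆ sobolevZero Ω k p) :
    SobolevBounded (zeroExtension F) ↔ SobolevBounded F := by
  constructor
  · rintro ⟨M, hM, hbound⟩
    refine ⟨M, hM, fun f hf => ?_⟩
    obtain ⟨g, hfg⟩ := exists_isZeroExtension (hF hf)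
    rw [← hfg.norm_eq (hF hf)]
    exact hbound g ⟨f, hf, hfg⟩
  · rintro ⟨M, hM, hbound⟩
    refine ⟨M, hM, ?_⟩
    rintro g ⟨f, hf, hfg⟩
    rw [hfg.norm_eq (hF hf)]
    exact hbound f hf

theorem SobolevBounded.lowTopBounded (hB : SobolevBounded F) : LowTopBounded F := by
  obtain ⟨M, hM, hbound⟩ := hB
  refine ⟨2 * M, by positivity, fun f hf => ?_⟩
  have norm_toLp_le : ‖f.toLp‖ ≤ ‖f‖ := by
    rw [← f.weakDeriv_zero_index]
    exact f.norm_weakDeriv_le_norm (zero_mem_multiIndicesLE d k)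
  have sum_top_le : ∑ α ∈ multiIndicesEq d k, ‖f.weakDeriv α‖ ≤ ‖f‖ :=
    Finset.sum_le_sum_of_subset_of_nonneg multiIndicesEq_subset fun _ _ _ => norm_nonneg _
  linarith [hbound f hf]

variable {i : Fin d} {R : ℝ}

theorem LowTopBounded.sobolevBounded (hp : p ≠ ⊤) (hR : 1 ≤ R) (hΩ : Ω ≤ slab i R)
    (hF : F ⊆ sobolevZero Ω k p) (hB : LowTopBounded F) : SobolevBounded F := by
  obtain ⟨M, hM, hbound⟩ := hB
  have hcard : 0 < (multiIndicesLE d k).card :=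
    Finset.card_pos.2 ⟨0, zero_mem_multiIndicesLE d k⟩
  refine ⟨(multiIndicesLE d k).card * (2 * R) ^ k * M, by positivity, fun f hf =>
    (norm_le_sum_norm_weakDeriv hp hR hΩ (hF hf)).trans ?_⟩
  gcongr
  linarith [hbound f hf, norm_nonneg f.toLp]

theorem TranslationEquicontinuous.top (hF : F ⊆ sobolevZero Ω k p)
    (hT : TranslationEquicontinuous (zeroExtension F)) : TopTranslationEquicontinuous F := by
  obtain ⟨δ, hδ, hδF⟩ := hT
  refine ⟨δ, hδ, fun f hf ε hε h hh => ?_⟩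
  obtain ⟨g, hfg⟩ := exists_isZeroExtension (hF hf)
  rw [sum_eLpNorm_indicator_shift_sub_lt_iff f h hε]
  refine lt_of_le_of_lt ?_ (hδF g ⟨f, hf, hfg⟩ ε hε h hh)
  rw [hfg.norm_translate_sub (hF hf)]
  exact Finset.sum_le_sum_of_subset_of_nonneg multiIndicesEq_subset fun _ _ _ => norm_nonneg _

theorem TopTranslationEquicontinuous.translationEquicontinuous (hp : p ≠ ⊤) (hR : 0 ≤ R)
    (hΩ : Ω ≤ slab i R) (hF : F ⊆ sobolevZero Ω k p) (hT : TopTranslationEquicontinuous F) :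
    TranslationEquicontinuous (zeroExtension F) := by
  obtain ⟨δ, hδ, hδF⟩ := hT
  have hcard : 0 < (multiIndicesLE d k).card :=
    Finset.card_pos.2 ⟨0, zero_mem_multiIndicesLE d k⟩
  set C : ℝ := (multiIndicesLE d k).card * (2 * (R + 1)) ^ k
  have hC : 0 < C := by positivity
  refine ⟨fun ε => min 1 (δ (ε / C)), fun ε hε => lt_min one_pos (hδ _ (by positivity)), ?_⟩
  rintro g ⟨f, hf, hfg⟩ ε hε h hh
  obtain ⟨hh_one, hh_delta⟩ := lt_min_iff.1 hh
  have top_lt := (sum_eLpNorm_indicator_shift_sub_lt_iff f h (by positivity)).1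
    (hδF f hf (ε / C) (by positivity) h hh_delta)
  rw [lt_div_iff₀' hC] at top_lt
  exact (hfg.norm_translate_sub_le hp hR hΩ (hF hf) hh_one).trans_lt top_lt

theorem exists_le_slab (hΩ : Bornology.IsBounded (Ω : Set (E d))) (i : Fin d) :
    ∃ R, Ω ≤ slab i R := by
  obtain ⟨R, hR⟩ := hΩ.subset_ball 0
  exact ⟨R, fun x hx => mem_slab.2
    ((PiLp.norm_apply_le x i).trans_lt (mem_ball_zero_iff.1 (hR hx)))⟩

end Criterion

end SobolevCompactness

end

open SobolevCompactness in
theorem corollary1p5_general {d k : ℕ} {p : ℝ≥0∞} [Fact (1 ≤ p)] (hp : p ≠ ⊤)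
    {Ω : Opens (E d)} {i : Fin d} {R : ℝ} (hΩ : Ω ≤ slab i R) {F : Set (Sobolev Ω k p)}
    (hF : F ⊆ sobolevZero Ω k p) :
    (∀ f ∈ F, ∃ g : Sobolev (⊤ : Opens (E d)) k p, IsZeroExtension f g ∧
      ∀ α ∈ multiIndicesLE d k,
        g.weakDeriv α =ᵐ[volume] (Ω : Set (E d)).indicator (f.weakDeriv α)) ∧
    (SobolevBounded F ↔ LowTopBounded F) ∧
    (TranslationEquicontinuous (zeroExtension F) ↔ TopTranslationEquicontinuous F) ∧
    List.TFAE [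
      SobolevPrecompact (zeroExtension F),
      SobolevBounded (zeroExtension F) ∧ TranslationEquicontinuous (zeroExtension F) ∧
        SmallAtInfinity (zeroExtension F),
      SobolevBounded (zeroExtension F) ∧ TopTranslationEquicontinuous F ∧
        SmallAtInfinity (zeroExtension F),
      LowTopBounded F ∧ TopTranslationEquicontinuous F ∧ SmallAtInfinity (zeroExtension F)] := by
  have hR : 1 ≤ max 1 R := le_max_left 1 R
  have hΩ_max : Ω ≤ slab i (max 1 R) := hΩ.trans (slab_mono (le_max_right 1 R))
  have hbdd : SobolevBounded F ↔ LowTopBounded F :=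
    ⟨fun h => h.lowTopBounded, fun h => h.sobolevBounded hp hR hΩ_max hF⟩
  have htrans : TranslationEquicontinuous (zeroExtension F) ↔ TopTranslationEquicontinuous F :=
    ⟨fun h => h.top hF, fun h =>
      h.translationEquicontinuous hp (zero_le_one.trans hR) hΩ_max hF⟩
  refine ⟨fun f hf => ?_, hbdd, htrans, ?_⟩
  · obtain ⟨g, hfg⟩ := exists_isZeroExtension (hF hf)
    refine ⟨g, hfg, fun α hα => ?_⟩
    rw [hfg.weakDeriv_eq (hF hf) hα]
    exact coeFn_extendLp (f.weakDeriv α)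
  · tfae_have 1 ↔ 2 := sobolevPrecompact_iff hp
    tfae_have 2 ↔ 3 := by rw [htrans]
    tfae_have 3 ↔ 4 := by rw [sobolevBounded_zeroExtension_iff hF, hbdd]
    tfae_finish

theorem corollary1p5 {d : ℕ} (hd : 1 ≤ d) (k : ℕ) (p : ENNReal) [Fact (1 ≤ p)] (hp : p ≠ ⊤)
    (Ω : TopologicalSpace.Opens (SobolevCompactness.E d))
    (hΩ : Bornology.IsBounded (Ω : Set (SobolevCompactness.E d)))
    (F : Set (SobolevCompactness.Sobolev Ω k p))
    (hF : F ⊆ SobolevCompactness.sobolevZero Ω k p) :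
    -- the extensions by zero belong to `W^{k,p}(ℝ^d)`, with derivatives the extended derivatives
    (∀ f ∈ F, ∃ g : SobolevCompactness.Sobolev (⊤ : TopologicalSpace.Opens _) k p,
      SobolevCompactness.IsZeroExtension f g ∧
      ∀ α ∈ SobolevCompactness.multiIndicesLE d k,
        g.weakDeriv α =ᵐ[MeasureTheory.volume]
          (Ω : Set (SobolevCompactness.E d)).indicator (f.weakDeriv α)) ∧
    -- the two boundedness conditions are equivalent
    (SobolevCompactness.SobolevBounded F ↔ SobolevCompactness.LowTopBounded F) ∧
    -- for bounded families the two translation conditions are equivalent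
    (SobolevCompactness.LowTopBounded F →
      (SobolevCompactness.TranslationEquicontinuous (SobolevCompactness.zeroExtension F) ↔
        SobolevCompactness.TopTranslationEquicontinuous F)) ∧
    -- the compactness criterion, with the original and with the replaced conditions
    List.TFAE [
      SobolevCompactness.SobolevPrecompact (SobolevCompactness.zeroExtension F),
      SobolevCompactness.SobolevBounded (SobolevCompactness.zeroExtension F) ∧
        SobolevCompactness.TranslationEquicontinuous (SobolevCompactness.zeroExtension F) ∧
        SobolevCompactness.SmallAtInfinity (SobolevCompactness.zeroExtension F),
      SobolevCompactness.SobolevBounded (SobolevCompactness.zeroExtension F) ∧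
        SobolevCompactness.TopTranslationEquicontinuous F ∧
        SobolevCompactness.SmallAtInfinity (SobolevCompactness.zeroExtension F),
      SobolevCompactness.LowTopBounded F ∧
        SobolevCompactness.TopTranslationEquicontinuous F ∧
        SobolevCompactness.SmallAtInfinity (SobolevCompactness.zeroExtension F)] := by
  open SobolevCompactness in
  obtain ⟨R, hR⟩ := exists_le_slab hΩ ⟨0, hd⟩
  obtain ⟨hext, hbdd, htrans, hcompact⟩ := corollary1p5_general hp hR hF
  exact ⟨hext, hbdd, fun _ => htrans, hcompact⟩
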